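/- **Theorem (minimax lower bound for community detection in degree-corrected block models).** *Setting.* For integers $n\ge 1$, $k\ge 2$, a vector $\theta\in[0,\infty)^n$ and reals $0<q<p$, $\beta\ge 1$, $\delta>0$, let $\mathcal P_n(\theta,p,q,k,\beta;\delta)$ be the set of matrices $P\in[0,1]^{n\times n}$ for which there are a label vector $z\in[k]^n$, with community sizes $n_u=n_u(z)=|\{i:z(i)=u\}|$, and a symmetric $B\in\mathbb R^{k\times k}$ such that $P_{ii}=0$ and $P_{ij}=\theta_i\theta_jB_{z(i)z(j)}$ for $i\ne j$; $\frac1{n_u}\sum_{i:z(i)=u}\theta_i\in[1-\delta,1+\delta]$ for all $u$; $\max_{u\ne v}B_{uv}\le q<p\le\min_uB_{uu}$; and $\frac n{\beta k}-1\le n_u\le\frac{\beta n}k+1$ for all $u$. Given $P$, one observes a symmetric $A\in\{0,1\}^{n\times n}$ with zero diagonal whose entries $A_{ij}$, $i<j$, are independent with $A_{ij}\sim\mathrm{Bern}(P_{ij})$. An estimator $\hat z$ is a map from such matrices to $[k]^n$, and its loss is $\ell(\hat z,z)=\frac1n\min_{\pi}|\{i:\hat z(i)\ne\pi(z(i))\}|$,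 the minimum being over all permutations $\pi$ of $[k]$. The minimax risk is $$R_n(\theta,p,q,k,\beta;\delta)=\inf_{\hat z}\ \sup_{\mathcal P_n(\theta,p,q,k,\beta;\delta)}\mathbb E\,\ell(\hat z,z),$$ where the supremum is over all $P\in\mathcal P_n$ and all label vectors $z$ that generate $P$ as above. Define $I$ by $$\exp(-I)=\begin{cases}\frac1n\sum_{i=1}^n\exp\left(-\theta_i\frac n2(\sqrt p-\sqrt q)^2\right),&k=2,\\[2pt]\frac1n\sum_{i=1}^n\exp\left(-\theta_i\frac n{\beta k}(\sqrt p-\sqrt q)^2\right),&k\ge3.\end{cases}$$ *Condition N.* There is a partition $\mathcal C_1,\dots,\mathcal C_k$ of $[n]$ with $|\mathcal C_u|^{-1}\sum_{i\in\mathcal C_u}\theta_i\in(1-\frac\delta4,1+\frac\delta4)$ for all $u\in[k]$ such that: if $k=2$, then $|\mathcal C_1|=\lfloor n/2\rfloor$ and $|\mathcal C_2|\in\{\lfloor n/2\rfloor,\lfloor n/2\rfloor+1\}$; if $k\ge3$, then $|\mathcal C_1|\le\dots\le|\mathcal C_k|$, $|\mathcal C_1|=|\mathcal C_2|=\lfloor\frac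 n{\beta k}\rfloor$, and $|\mathcal C_k|\le\frac{\beta n}k+1$. *Statement.* Fix $\beta\ge1$ and consider any sequence of such problems, in which $n\to\infty$ (along all integers or along a subsequence) and $\theta,p,q,k,\delta$ may depend on $n$. Assume that $\delta\to0$, $\delta n\ge4\beta k$ for all sufficiently large $n$, $I\to\infty$, $1<p/q=O(1)$, $p\|\theta\|_\infty^2=o(1)$, $\log k=o(I)$, $\log(1/\delta)=o(I)$, and that $\theta$ satisfies Condition N. Then $$\liminf_{n\to\infty}\ \frac1I\log R_n(\theta,p,q,k,\beta;\delta)\ \ge\ -1,$$ with the convention $\log 0=-\infty$; that is, $R_n\ge\exp(-(1+o(1))I)$. -/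

import Mathlib

open Filter Topology Asymptotics

noncomputable section

namespace DCBM

/-- Unordered pairs of distinct nodes of `[n]`, written with the smaller node first. -/
abbrev Pair (n : ℕ) : Type := {e : Fin n × Fin n // e.1 < e.2}

/-- The part above the diagonal of an adjacency matrix `A`; as `A` is symmetric with zero diagonal,
this is the whole observation. -/
abbrev Adjacency (n : ℕ) : Type := Pair n → Bool

/-- The size `n_u(z)` of the community `u` under the labelling `z`. -/
def commSize {n k : ℕ} (z : Fin n → Fin k) (u : Fin k) : ℕ :=
  (Finset.univ.filter fun i => z i = u).card

/-- The average of the degree-correction parameters over the community `u`. -/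
def commAvg {n k : ℕ} (θ : Fin n → ℝ) (z : Fin n → Fin k) (u : Fin k) : ℝ :=
  (∑ i ∈ Finset.univ.filter (fun i => z i = u), θ i) / (commSize z u : ℝ)

/-- The parameter space. An element is a matrix `P` of connection probabilities together with a
label vector `z` that generates it. -/
def paramSpace (n : ℕ) (θ : Fin n → ℝ) (p q : ℝ) (k : ℕ) (β δ : ℝ) :
    Set ((Fin n → Fin k) × Matrix (Fin n) (Fin n) ℝ) :=
  {x | (∀ i j, x.2 i j ∈ Set.Icc (0 : ℝ) 1) ∧
    ∃ B : Matrix (Fin k) (Fin k) ℝ, B.IsSymm ∧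
      (∀ i, x.2 i i = 0) ∧
      (∀ i j, i ≠ j → x.2 i j = θ i * θ j * B (x.1 i) (x.1 j)) ∧
      (∀ u, commAvg θ x.1 u ∈ Set.Icc (1 - δ) (1 + δ)) ∧
      (∀ u v, u ≠ v → B u v ≤ q) ∧ q < p ∧ (∀ u, p ≤ B u u) ∧
      (∀ u, (n : ℝ) / (β * k) - 1 ≤ (commSize x.1 u : ℝ) ∧
        (commSize x.1 u : ℝ) ≤ β * n / k + 1)}

/-- The probability of observing `A` when the entries `A_{ij}`, `i < j`, are independent and
`A_{ij}` is Bernoulli with success probability `P_{ij}`. -/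
def prob {n : ℕ} (P : Matrix (Fin n) (Fin n) ℝ) (A : Adjacency n) : ℝ :=
  ∏ e : Pair n, if A e then P e.1.1 e.1.2 else 1 - P e.1.1 e.1.2

/-- The proportion of misclassified nodes, up to a permutation of the labels. -/
def loss {n k : ℕ} (zhat z : Fin n → Fin k) : ℝ :=
  ((⨅ π : Equiv.Perm (Fin k), hammingDist zhat (π ∘ z) : ℕ) : ℝ) / n

/-- The expected loss of the estimator `zhat` when the truth is `z` and `A` has law `prob P`. -/
def risk {n k : ℕ} (zhat : Adjacency n → Fin n → Fin k) (z : Fin n → Fin k)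
    (P : Matrix (Fin n) (Fin n) ℝ) : ℝ :=
  ∑ A : Adjacency n, prob P A * loss (zhat A) z

/-- The minimax risk over the parameter space; the infimum is over all estimators. -/
def minimaxRisk (n : ℕ) (θ : Fin n → ℝ) (p q : ℝ) (k : ℕ) (β δ : ℝ) : ENNReal :=
  ⨅ zhat : Adjacency n → Fin n → Fin k, ⨆ x ∈ paramSpace n θ p q k β δ,
    ENNReal.ofReal (risk zhat x.1 x.2)

/-- The quantity `I`, defined through `exp (-I) = (1/n) ∑ i, exp (-θ_i m (√p - √q)²)`, where
`m = n/2` if `k = 2` and `m = n/(βk)` if `k ≥ 3`. -/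
def rateI (n : ℕ) (θ : Fin n → ℝ) (p q : ℝ) (k : ℕ) (β : ℝ) : ℝ :=
  -Real.log ((1 / (n : ℝ)) * ∑ i, Real.exp
    (-(θ i * (if k = 2 then (n : ℝ) / 2 else (n : ℝ) / (β * k)) * (√p - √q) ^ 2)))

/-- Condition N. The partition of `[n]` is given by the level sets of `z`; the first two of them
are those of the labels `0` and `1`. -/
def ConditionN (n : ℕ) (θ : Fin n → ℝ) (k : ℕ) (β δ : ℝ) : Prop :=
  ∃ z : Fin n → Fin k,
    (∀ u, commAvg θ z u ∈ Set.Ioo (1 - δ / 4) (1 + δ / 4)) ∧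
    (k = 2 → ∀ u : Fin k,
      (u.val = 0 → commSize z u = n / 2) ∧
      (u.val = 1 → commSize z u = n / 2 ∨ commSize z u = n / 2 + 1)) ∧
    (3 ≤ k →
      Monotone (commSize z) ∧
      (∀ u : Fin k, u.val < 2 → commSize z u = ⌊(n : ℝ) / (β * k)⌋₊) ∧
      (∀ u : Fin k, (commSize z u : ℝ) ≤ β * n / k + 1))

end DCBM

end

/-!
The lower bound comes from confusing single nodes of small weight between two communities.

Write `D = (√p - √q)²`, let `M` be the size, up to rounding, of the first two communities
(`n / 2` or `n / (βk)`), and put `J i = θ i * M * D`, so that `exp (-I)` is the average of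
`exp (-J i)`. Let `T` consist of
the `2a + 1` nodes of smallest weight, where `a` is about `δ n / (64 β k)`. Starting from the
partition of Condition N, the nodes of `T` change places with nodes of small weight in the first two
communities and one node of a largest community. After that, every split of `T` into parts of sizes
`a` and `a + 1`, given the labels `0` and `1`, is admissible (`exists_base_label`): no size leaves
its range, since the largest community can spare a node, and so few nodes move that the averages
stay in `[1 - δ, 1 + δ]`.

Put the uniform prior on these splits, with probabilities `θ_i θ_j p` within and `θ_i θ_j q` between
communities. As `T` is small, the permutation in the loss does not help the estimator
(`exists_relabel_le_loss`). Given all labels but that of `i ∈ T`, both labels of `i` remain possible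
with a probability bounded below, so the Bayes risk is, up to a constant, at least `1 / n` times the
sum over `T` of the testing affinities `∑_A min (P A, P' A)` (`exists_le_risk`).

For such an affinity, compare `P` and `P'` with the product law `r` in which the edges at `i` have
the geometric mean `θ_i θ_j √(pq)` as their probability. By Jensen's inequality the affinity is at
least `exp` of minus the larger of the divergences of `r` from `P` and `P'`, up to a term controlled
by the variances of the log-likelihood ratios (`exp_le_sum_min_prod`). Each of the two divergences
has one nonnegative part from either community. These parts are linear in the total weight of the
community, up to lower order terms, and the logarithms in them cancel when the weights are equal, so
a bound `W` on both weights bounds the divergences by `(1 + o(1)) θ_i W D`. The variances are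
`O(J i)` (`exists_edge_law`, `exp_le_sum_min_prob`).

Since `T` carries the smallest weights, the average of `exp (-c J i)` over `T` is at least that over
all nodes, which by Jensen's inequality is at least `exp (-c I)`. The risk is therefore at least a
constant times `(δ / k) exp (-c I)` with `c` close to `1` (`le_minimaxRisk`), and the factor
`δ / k` is `exp (-o(I))`.
-/

namespace DCBM

/-! ### Subsets carrying the smallest values of a function -/

theorem exists_subset_smallest {α : Type*} [DecidableEq α] (f : α → ℝ) (C : Finset α) {c : ℕ}
    (hc : c ≤ C.card) :
    ∃ F ⊆ C, F.card = c ∧ ∀ i ∈ F, ∀ j ∈ C \ F, f i ≤ f j := by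
  induction c with
  | zero => exact ⟨∅, by simp, by simp, by simp⟩
  | succ c ih =>
    obtain ⟨F, hFC, hFc, hF⟩ := ih (by omega)
    have hne : (C \ F).Nonempty := by
      rw [← Finset.card_pos, Finset.card_sdiff_of_subset hFC]; omega
    obtain ⟨x, hx, hmin⟩ := Finset.exists_min_image (C \ F) f hne
    rw [Finset.mem_sdiff] at hx
    refine ⟨insert x F, Finset.insert_subset hx.1 hFC, ?_, ?_⟩
    · rw [Finset.card_insert_of_notMem hx.2, hFc]
    · intro i hi j hj
      rw [Finset.mem_sdiff, Finset.mem_insert, not_or] at hj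
      have hj' : j ∈ C \ F := Finset.mem_sdiff.2 ⟨hj.1, hj.2.2⟩
      rcases Finset.mem_insert.1 hi with rfl | hi
      · exact hmin j hj'
      · exact hF i hi j hj'

/-- The average over a subset carrying the smallest values is at most the overall average, written
without division. -/
theorem card_mul_sum_le_of_smallest {α : Type*} [DecidableEq α] (f : α → ℝ) {C F : Finset α}
    (hFC : F ⊆ C) (hF : ∀ i ∈ F, ∀ j ∈ C \ F, f i ≤ f j) :
    (C.card : ℝ) * ∑ i ∈ F, f i ≤ F.card * ∑ i ∈ C, f i := by
  have h1 : ∑ i ∈ F, ∑ _j ∈ C \ F, f i ≤ ∑ _i ∈ F, ∑ j ∈ C \ F, f j :=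
    Finset.sum_le_sum fun i hi => Finset.sum_le_sum fun j hj => hF i hi j hj
  simp only [Finset.sum_const, nsmul_eq_mul] at h1
  rw [← Finset.mul_sum] at h1
  have h2 := Finset.sum_sdiff (f := f) hFC
  have h3 : ((C \ F).card : ℝ) + F.card = C.card := by
    exact_mod_cast Finset.card_sdiff_add_card_eq_card hFC
  rw [← h2, ← h3]
  linarith

/-! ### An affinity bound for product measures -/

section Affinity

variable {ι : Type*} [Fintype ι] [DecidableEq ι]

theorem sum_prod_mul_single (r : ι → Bool → ℝ) (hr : ∀ e, ∑ x, r e x = 1) (e : ι) (f : Bool → ℝ) :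
    ∑ A : ι → Bool, (∏ g, r g (A g)) * f (A e) = ∑ x, r e x * f x := by
  have h : ∀ A : ι → Bool, (∏ g, r g (A g)) * f (A e)
      = ∏ g, r g (A g) * (if g = e then f (A g) else 1) := by
    intro A
    rw [Finset.prod_mul_distrib, Finset.prod_ite_eq' Finset.univ e]
    simp
  simp_rw [h]
  rw [← Fintype.prod_sum (fun g x => r g x * (if g = e then f x else 1)),
    ← Finset.mul_prod_erase Finset.univ _ (Finset.mem_univ e)]
  rw [Finset.prod_eq_one]
  · simp
  · intro g hg
    simpa [Finset.ne_of_mem_erase hg] using hr g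

theorem sum_prod_mul_pair (r : ι → Bool → ℝ) (hr : ∀ e, ∑ x, r e x = 1) {e e' : ι} (hne : e ≠ e')
    (f f' : Bool → ℝ) :
    ∑ A : ι → Bool, (∏ g, r g (A g)) * (f (A e) * f' (A e'))
      = (∑ x, r e x * f x) * ∑ x, r e' x * f' x := by
  have h : ∀ A : ι → Bool, (∏ g, r g (A g)) * (f (A e) * f' (A e'))
      = ∏ g, r g (A g) * ((if g = e then f (A g) else 1) * (if g = e' then f' (A g) else 1)) := by
    intro A
    rw [Finset.prod_mul_distrib, Finset.prod_mul_distrib, Finset.prod_ite_eq' Finset.univ e,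
      Finset.prod_ite_eq' Finset.univ e']
    simp
  simp_rw [h]
  rw [← Fintype.prod_sum (fun g x => r g x *
      ((if g = e then f x else 1) * (if g = e' then f' x else 1))),
    ← Finset.mul_prod_erase Finset.univ _ (Finset.mem_univ e),
    ← Finset.mul_prod_erase _ _ (Finset.mem_erase.2 ⟨hne.symm, Finset.mem_univ e'⟩)]
  rw [Finset.prod_eq_one]
  · simp [hne, hne.symm]
  · intro g hg
    rw [Finset.mem_erase, Finset.mem_erase] at hg
    simpa [hg.1, hg.2.1] using hr g

/-- The variance of a sum of independent variables is the sum of the variances. -/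
theorem sum_prod_mul_sq_of_centered (r : ι → Bool → ℝ) (hr : ∀ e, ∑ x, r e x = 1)
    (f : ι → Bool → ℝ) (hf : ∀ e, ∑ x, r e x * f e x = 0) :
    ∑ A : ι → Bool, (∏ g, r g (A g)) * (∑ e, f e (A e)) ^ 2 = ∑ e, ∑ x, r e x * f e x ^ 2 := by
  have h : ∀ A : ι → Bool, (∏ g, r g (A g)) * (∑ e, f e (A e)) ^ 2
      = ∑ e, ∑ e', (∏ g, r g (A g)) * (f e (A e) * f e' (A e')) := by
    intro A
    rw [sq, Finset.sum_mul_sum, Finset.mul_sum]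
    simp_rw [Finset.mul_sum]
  simp_rw [h]
  rw [Finset.sum_comm]
  refine Finset.sum_congr rfl fun e _ => ?_
  rw [Finset.sum_comm, Finset.sum_eq_single e]
  · rw [sum_prod_mul_single r hr e (fun x => f e x * f e x)]
    simp_rw [sq]
  · intro e' _ hne
    rw [sum_prod_mul_pair r hr hne.symm, hf, zero_mul]
  · simp

/-- A lower bound on the total mass of the minimum of two product measures `∏ P` and `∏ Q`, by
comparison with a third product measure `∏ r`. Here `X` and `Y` are the log-likelihood ratios of
`r` against `P` and `Q`, the bound `m` is on the two Kullback–Leibler divergences and `V` on the two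
variances. The proof is Jensen's inequality for `exp`. -/
theorem exp_le_sum_min_prod (P Q r X Y : ι → Bool → ℝ) (hr0 : ∀ e x, 0 ≤ r e x)
    (hr : ∀ e, ∑ x, r e x = 1)
    (hP : ∀ e x, r e x * Real.exp (-X e x) ≤ P e x)
    (hQ : ∀ e x, r e x * Real.exp (-Y e x) ≤ Q e x) {m V η : ℝ} (hη : 0 < η)
    (hmX : ∑ e, ∑ x, r e x * X e x ≤ m) (hmY : ∑ e, ∑ x, r e x * Y e x ≤ m)
    (hVX : ∑ e, ∑ x, r e x * (X e x - ∑ y, r e y * X e y) ^ 2 ≤ V)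
    (hVY : ∑ e, ∑ x, r e x * (Y e x - ∑ y, r e y * Y e y) ^ 2 ≤ V) :
    Real.exp (-(m + 2 * η * V + 1 / (2 * η))) ≤
      ∑ A : ι → Bool, min (∏ e, P e (A e)) (∏ e, Q e (A e)) := by
  have hcent : ∀ Z : ι → Bool → ℝ, ∀ e, ∑ x, r e x * (Z e x - ∑ y, r e y * Z e y) = 0 := by
    intro Z e
    simp_rw [mul_sub]
    rw [Finset.sum_sub_distrib, ← Finset.sum_mul, hr, one_mul, sub_self]
  set R : (ι → Bool) → ℝ := fun A => ∏ g, r g (A g) with hR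
  have hR0 : ∀ A, 0 ≤ R A := fun A => Finset.prod_nonneg fun g _ => hr0 _ _
  have hR1 : ∑ A, R A = 1 := by
    rw [hR, ← Fintype.prod_sum]; exact Finset.prod_eq_one fun g _ => hr g
  set fX : (ι → Bool) → ℝ := fun A => ∑ e, (X e (A e) - ∑ y, r e y * X e y) with hfX
  set fY : (ι → Bool) → ℝ := fun A => ∑ e, (Y e (A e) - ∑ y, r e y * Y e y) with hfY
  have hvX : ∑ A, R A * fX A ^ 2 ≤ V :=
    (sum_prod_mul_sq_of_centered r hr (fun e x => X e x - ∑ y, r e y * X e y) (hcent X)).trans_le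
      hVX
  have hvY : ∑ A, R A * fY A ^ 2 ≤ V :=
    (sum_prod_mul_sq_of_centered r hr (fun e x => Y e x - ∑ y, r e y * Y e y) (hcent Y)).trans_le
      hVY
  set K := m + 2 * η * V + 1 / (2 * η) with hK
  -- `M` dominates both log-likelihood ratios, and its mean is at most `K`.
  set M : (ι → Bool) → ℝ := fun A => m + η * fX A ^ 2 + η * fY A ^ 2 + 1 / (2 * η) with hM
  have habs : ∀ z : ℝ, z ≤ η * z ^ 2 + 1 / (2 * η) := by
    intro z
    have h : η * z ^ 2 + 1 / (2 * η) - z = ((η * z - 1 / 2) ^ 2 + 1 / 4) / η := by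
      field_simp; ring
    have h2 : 0 ≤ ((η * z - 1 / 2) ^ 2 + 1 / 4) / η := by positivity
    linarith
  have hXM : ∀ A, ∑ e, X e (A e) ≤ M A := by
    intro A
    have h : fX A = ∑ e, X e (A e) - ∑ e, ∑ y, r e y * X e y := by
      rw [hfX]; simp only; rw [Finset.sum_sub_distrib]
    have h1 := habs (fX A)
    have h2 : 0 ≤ η * fY A ^ 2 := by positivity
    simp only [hM]; linarith
  have hYM : ∀ A, ∑ e, Y e (A e) ≤ M A := by
    intro A
    have h : fY A = ∑ e, Y e (A e) - ∑ e, ∑ y, r e y * Y e y := by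
      rw [hfY]; simp only; rw [Finset.sum_sub_distrib]
    have h1 := habs (fY A)
    have h2 : 0 ≤ η * fX A ^ 2 := by positivity
    simp only [hM]; linarith
  have hprod : ∀ (Z : ι → Bool → ℝ) (W : ι → Bool → ℝ),
      (∀ e x, r e x * Real.exp (-Z e x) ≤ W e x) → (∀ A, ∑ e, Z e (A e) ≤ M A) →
      ∀ A : ι → Bool, R A * Real.exp (-M A) ≤ ∏ e, W e (A e) := by
    intro Z W hW hZ A
    calc R A * Real.exp (-M A) ≤ R A * Real.exp (-∑ e, Z e (A e)) := by
          gcongr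
          · exact hR0 A
          · exact hZ A
      _ = ∏ e, r e (A e) * Real.exp (-Z e (A e)) := by
          rw [Finset.prod_mul_distrib, ← Real.exp_sum, Finset.sum_neg_distrib]
      _ ≤ ∏ e, W e (A e) := by
          apply Finset.prod_le_prod
          · intro e _; exact mul_nonneg (hr0 _ _) (Real.exp_pos _).le
          · intro e _; exact hW _ _
  have hmin : ∀ A : ι → Bool,
      R A * (Real.exp (-K) * (1 + K - M A)) ≤ min (∏ e, P e (A e)) (∏ e, Q e (A e)) := by
    intro A
    have h1 : Real.exp (-K) * (1 + K - M A) ≤ Real.exp (-M A) := by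
      have h := Real.add_one_le_exp (K - M A)
      calc Real.exp (-K) * (1 + K - M A) ≤ Real.exp (-K) * Real.exp (K - M A) := by
            gcongr; linarith
        _ = Real.exp (-M A) := by rw [← Real.exp_add]; ring_nf
    have h2 := mul_le_mul_of_nonneg_left h1 (hR0 A)
    exact le_min (h2.trans (hprod X P hP hXM A)) (h2.trans (hprod Y Q hQ hYM A))
  refine le_trans ?_ (Finset.sum_le_sum fun A _ => hmin A)
  have hsum : ∑ A, R A * (Real.exp (-K) * (1 + K - M A)) =
      Real.exp (-K) * (1 + K - (m + 1 / (2 * η)) - η * ∑ A, R A * fX A ^ 2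
        - η * ∑ A, R A * fY A ^ 2) := by
    have : ∀ A, R A * (Real.exp (-K) * (1 + K - M A)) =
        Real.exp (-K) * ((1 + K - (m + 1 / (2 * η))) * R A - η * (R A * fX A ^ 2)
          - η * (R A * fY A ^ 2)) := by
      intro A; simp only [hM]; ring
    simp_rw [this]
    rw [← Finset.mul_sum, Finset.sum_sub_distrib, Finset.sum_sub_distrib, ← Finset.mul_sum, hR1,
      ← Finset.mul_sum, ← Finset.mul_sum, mul_one]
  rw [hsum]
  have h3 : 1 ≤ 1 + K - (m + 1 / (2 * η)) - η * ∑ A, R A * fX A ^ 2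
        - η * ∑ A, R A * fY A ^ 2 := by
    have h4 := mul_le_mul_of_nonneg_left hvX hη.le
    have h5 := mul_le_mul_of_nonneg_left hvY hη.le
    rw [hK]; linarith
  exact le_mul_of_one_le_right (Real.exp_pos _).le h3

end Affinity

/-! ### Comparing Bernoulli laws with their geometric mean -/

/-- The probability mass function of the Bernoulli law with success probability `a`. -/
noncomputable def bern (a : ℝ) (x : Bool) : ℝ := if x then a else 1 - a

theorem sum_bern (a : ℝ) : ∑ x, bern a x = 1 := by simp [bern]

theorem bern_nonneg {a : ℝ} (h0 : 0 ≤ a) (h1 : a ≤ 1) (x : Bool) : 0 ≤ bern a x := by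
  cases x <;> simp [bern, h0, h1]

/-- The log-likelihood ratio of the Bernoulli law with parameter `ρ` against that with parameter
`a`. The value at a success is passed as `τ`, so that it also makes sense for `ρ = a = 0`. -/
noncomputable def bernLLR (τ ρ a : ℝ) (x : Bool) : ℝ :=
  if x then τ else Real.log ((1 - ρ) / (1 - a))

theorem bern_mul_exp_le {τ ρ a : ℝ} (hρ : ρ < 1) (ha : a < 1) (h : ρ * Real.exp (-τ) ≤ a)
    (x : Bool) : bern ρ x * Real.exp (-bernLLR τ ρ a x) ≤ bern a x := by
  cases x
  · have h1 : 0 < 1 - ρ := by linarith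
    have h2 : 0 < 1 - a := by linarith
    simp only [bern, bernLLR, Bool.false_eq_true, if_false]
    rw [Real.exp_neg, Real.exp_log (by positivity)]
    apply le_of_eq; field_simp
  · simpa [bern, bernLLR] using h

/-- The Kullback–Leibler divergence of two Bernoulli laws exceeds that of the Poisson laws with the
same means by a quadratic term at most. -/
theorem sum_bern_mul_llr_le {τ ρ a : ℝ} (hρ : ρ ≤ 1 / 2) (ha : a ≤ 1 / 2) :
    ∑ x, bern ρ x * bernLLR τ ρ a x ≤ ρ * τ + (a - ρ) + 2 * (a - ρ) ^ 2 := by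
  have h1 : 0 < 1 - ρ := by linarith
  have h2 : 0 < 1 - a := by linarith
  have hlog : Real.log ((1 - ρ) / (1 - a)) ≤ (1 - ρ) / (1 - a) - 1 :=
    Real.log_le_sub_one_of_pos (by positivity)
  have h3 := mul_le_mul_of_nonneg_left hlog h1.le
  have h4 : (1 - ρ) * ((1 - ρ) / (1 - a) - 1) = (a - ρ) + (a - ρ) ^ 2 / (1 - a) := by
    field_simp; ring
  have h5 : (a - ρ) ^ 2 / (1 - a) ≤ 2 * (a - ρ) ^ 2 := by
    rw [div_le_iff₀ h2]
    nlinarith [sq_nonneg (a - ρ)]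
  simp only [Fintype.sum_bool, bern, bernLLR, if_true, Bool.false_eq_true, if_false]
  linarith

theorem abs_log_div_le {ρ a : ℝ} (hρ : ρ ≤ 1 / 2) (ha : a ≤ 1 / 2) :
    |Real.log ((1 - ρ) / (1 - a))| ≤ 2 * |a - ρ| := by
  have key : ∀ x y : ℝ, x ≤ 1 / 2 → y ≤ 1 / 2 →
      Real.log ((1 - x) / (1 - y)) ≤ 2 * |y - x| := by
    intro x y hx hy
    have h1 : 0 < 1 - x := by linarith
    have h2 : 0 < 1 - y := by linarith
    have hlog : Real.log ((1 - x) / (1 - y)) ≤ (1 - x) / (1 - y) - 1 :=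
      Real.log_le_sub_one_of_pos (by positivity)
    have h3 : (1 - x) / (1 - y) - 1 = (y - x) / (1 - y) := by field_simp; ring
    have h4 : (y - x) / (1 - y) ≤ 2 * |y - x| := by
      rw [div_le_iff₀ h2]
      nlinarith [le_abs_self (y - x), abs_nonneg (y - x)]
    linarith
  rw [abs_le]
  constructor
  · have h := key a ρ ha hρ
    rw [abs_sub_comm, ← inv_div, Real.log_inv] at h
    linarith
  · exact key ρ a hρ ha

theorem variance_bern_llr_le {τ ρ a : ℝ} (hρ0 : 0 ≤ ρ) (hρ : ρ ≤ 1 / 2) (ha : a ≤ 1 / 2) :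
    ∑ x, bern ρ x * (bernLLR τ ρ a x - ∑ y, bern ρ y * bernLLR τ ρ a y) ^ 2 ≤
      ρ * (2 * τ ^ 2 + 8 * (a - ρ) ^ 2) := by
  have habs := abs_log_div_le hρ ha
  have hsq : Real.log ((1 - ρ) / (1 - a)) ^ 2 ≤ 4 * (a - ρ) ^ 2 := by
    have h := pow_le_pow_left₀ (abs_nonneg _) habs 2
    rw [mul_pow, sq_abs, sq_abs] at h
    linarith
  set l := Real.log ((1 - ρ) / (1 - a)) with hl
  have heq : ∑ x, bern ρ x * (bernLLR τ ρ a x - ∑ y, bern ρ y * bernLLR τ ρ a y) ^ 2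
      = ρ * ((1 - ρ) * (τ - l) ^ 2) := by
    simp only [Fintype.sum_bool, bern, bernLLR, if_true, Bool.false_eq_true, if_false, ← hl]
    ring
  rw [heq]
  have h1 : (1 - ρ) * (τ - l) ^ 2 ≤ (τ - l) ^ 2 := by nlinarith [sq_nonneg (τ - l)]
  have h2 : (τ - l) ^ 2 ≤ 2 * τ ^ 2 + 2 * l ^ 2 := by nlinarith [sq_nonneg (τ + l)]
  exact mul_le_mul_of_nonneg_left (by linarith) hρ0

/-! ### One edge of the graph -/

/-- Up to the factor `θ_i θ_j`, a bound on the divergence of the law with mean `√(pq)` from the law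
with mean `p`; see `exists_edge_law`. -/
noncomputable def klIn (p q ω : ℝ) : ℝ :=
  p - √p * √q - √p * √q * Real.log (√p / √q) + 2 * ω * (√p - √q) ^ 2

/-- Up to the factor `θ_i θ_j`, a bound on the divergence of the law with mean `√(pq)` from the law
with mean `q`; see `exists_edge_law`. -/
noncomputable def klOut (p q ω : ℝ) : ℝ :=
  q - √p * √q + √p * √q * Real.log (√p / √q) + 2 * ω * (√p - √q) ^ 2

theorem klIn_nonneg {p q ω : ℝ} (hq : 0 < q) (hpq : q < p) (hω : 0 ≤ ω) : 0 ≤ klIn p q ω := by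
  have hp : 0 < p := hq.trans hpq
  have hsp := Real.sqrt_pos.2 hp
  have hsq := Real.sqrt_pos.2 hq
  have hlog : Real.log (√p / √q) ≤ √p / √q - 1 := Real.log_le_sub_one_of_pos (by positivity)
  have h := mul_le_mul_of_nonneg_left hlog (mul_pos hsp hsq).le
  have h2 : √p * √q * (√p / √q - 1) = p - √p * √q := by
    have := Real.mul_self_sqrt hp.le
    field_simp
    nlinarith
  have h3 : 0 ≤ 2 * ω * (√p - √q) ^ 2 := by positivity
  unfold klIn; linarith

theorem klOut_nonneg {p q ω : ℝ} (hq : 0 < q) (hpq : q < p) (hω : 0 ≤ ω) : 0 ≤ klOut p q ω := by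
  have hp : 0 < p := hq.trans hpq
  have hsp := Real.sqrt_pos.2 hp
  have hsq := Real.sqrt_pos.2 hq
  have hlog : Real.log (√q / √p) ≤ √q / √p - 1 := Real.log_le_sub_one_of_pos (by positivity)
  have h := mul_le_mul_of_nonneg_left hlog (mul_pos hsp hsq).le
  have h2 : √p * √q * (√q / √p - 1) = q - √p * √q := by
    have := Real.mul_self_sqrt hq.le
    field_simp
    nlinarith
  have hinv : Real.log (√q / √p) = -Real.log (√p / √q) := by rw [← Real.log_inv, inv_div]
  rw [hinv, h2] at h
  have h3 : 0 ≤ 2 * ω * (√p - √q) ^ 2 := by positivity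
  unfold klOut; linarith

/-- The logarithmic terms cancel in the sum. Hence a common bound on the weights of the two
communities is enough: neither divergence alone need be close to half of the right-hand side. -/
theorem klIn_add_klOut {p q ω : ℝ} (hp : 0 ≤ p) (hq : 0 ≤ q) :
    klIn p q ω + klOut p q ω = (1 + 4 * ω) * (√p - √q) ^ 2 := by
  have h1 := Real.mul_self_sqrt hp
  have h2 := Real.mul_self_sqrt hq
  unfold klIn klOut
  linear_combination (-1 : ℝ) * h1 - h2

/-- A law `r` intermediate between the Bernoulli laws with parameters `up` and `uq`, namely the one
with parameter `u√(pq)`, and the log-likelihood ratios `X` and `Y` of `r` against them, with bounds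
on means and variances. -/
theorem exists_edge_law {p q ω K u : ℝ} (hq : 0 < q) (hpq : q < p) (hK : p / q ≤ K) (hu : 0 ≤ u)
    (huω : p * u ≤ ω) (hω : ω ≤ 1 / 2) :
    ∃ r X Y : Bool → ℝ, (∀ x, 0 ≤ r x) ∧ ∑ x, r x = 1 ∧
      (∀ x, r x * Real.exp (-X x) ≤ bern (u * p) x) ∧
      (∀ x, r x * Real.exp (-Y x) ≤ bern (u * q) x) ∧
      ∑ x, r x * X x ≤ u * klIn p q ω ∧ ∑ x, r x * Y x ≤ u * klOut p q ω ∧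
      ∑ x, r x * (X x - ∑ y, r y * X y) ^ 2 ≤ u * ((2 * K + 4) * (√p - √q) ^ 2) ∧
      ∑ x, r x * (Y x - ∑ y, r y * Y y) ^ 2 ≤ u * ((2 * K + 4) * (√p - √q) ^ 2) := by
  have hp : 0 < p := hq.trans hpq
  have hs : 0 < √p := Real.sqrt_pos.2 hp
  have hs' : 0 < √q := Real.sqrt_pos.2 hq
  have hss : √q < √p := Real.sqrt_lt_sqrt hq.le hpq
  have hmp : √p * √p = p := Real.mul_self_sqrt hp.le
  have hmq : √q * √q = q := Real.mul_self_sqrt hq.le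
  unfold klIn klOut
  set s := √p with hsdef
  set s' := √q with hsdef'
  set t := Real.log (s / s') with ht
  have hexp : Real.exp t = s / s' := Real.exp_log (by positivity)
  have ht0 : 0 ≤ t := Real.log_nonneg ((one_le_div hs').2 hss.le)
  have ht1 : s' * t ≤ s - s' := by
    have hlog : t ≤ s / s' - 1 := Real.log_le_sub_one_of_pos (by positivity)
    calc s' * t ≤ s' * (s / s' - 1) := by gcongr
      _ = s - s' := by field_simp
  -- `√(pq) t² ≤ (p/q) q t² ≤ K (√p - √q)²`
  have hgt : s * s' * t ^ 2 ≤ K * (s - s') ^ 2 := by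
    have h1 : (s' * t) ^ 2 ≤ (s - s') ^ 2 := pow_le_pow_left₀ (by positivity) ht1 2
    have h2 : p ≤ K * q := (div_le_iff₀ hq).1 hK
    have h3 : s * s' ≤ p := by rw [← hmp]; gcongr
    have hK0 : 0 ≤ K := (div_pos hp hq).le.trans hK
    calc s * s' * t ^ 2 ≤ K * q * t ^ 2 := mul_le_mul_of_nonneg_right (h3.trans h2) (sq_nonneg t)
      _ = K * (s' * t) ^ 2 := by rw [← hmq]; ring
      _ ≤ K * (s - s') ^ 2 := by gcongr
  have hup : u * p ≤ 1 / 2 := by linarith [mul_comm u p]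
  have hg : s * s' ≤ p := by rw [← hmp]; gcongr
  have huq : u * q ≤ u * p := by gcongr
  have hρ : u * (s * s') ≤ u * p := by gcongr
  have hρ0 : 0 ≤ u * (s * s') := by positivity
  -- the two squared distances to the intermediate parameter
  have hd1 : (u * p - u * (s * s')) ^ 2 ≤ u * (ω * (s - s') ^ 2) := by
    have h : (u * p - u * (s * s')) ^ 2 = u * ((p * u) * (s - s') ^ 2) := by
      rw [← hmp]; ring
    rw [h]; gcongr
  have hd2 : (u * q - u * (s * s')) ^ 2 ≤ u * (ω * (s - s') ^ 2) := by
    have h : (u * q - u * (s * s')) ^ 2 = u * ((q * u) * (s - s') ^ 2) := by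
      rw [← hmq]; ring
    have h' : q * u ≤ ω := le_trans (by gcongr) huω
    rw [h]; gcongr
  have hωD : u * (ω * (s - s') ^ 2) ≤ u * (1 / 2 * (s - s') ^ 2) := by gcongr
  have hvar : ∀ a τ : ℝ, τ ^ 2 = t ^ 2 → (a - u * (s * s')) ^ 2 ≤ u * (ω * (s - s') ^ 2) →
      u * (s * s') * (2 * τ ^ 2 + 8 * (a - u * (s * s')) ^ 2) ≤
        u * ((2 * K + 4) * (s - s') ^ 2) := by
    intro a τ hτ ha
    rw [hτ]
    have h1 : u * (s * s' * t ^ 2) ≤ u * (K * (s - s') ^ 2) := by gcongr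
    have h2 : u * (s * s') * (a - u * (s * s')) ^ 2 ≤ 1 * (u * (1 / 2 * (s - s') ^ 2)) := by
      apply mul_le_mul _ (ha.trans hωD) (sq_nonneg _) zero_le_one
      linarith
    linarith
  refine ⟨bern (u * (s * s')), bernLLR (-t) (u * (s * s')) (u * p),
    bernLLR t (u * (s * s')) (u * q), bern_nonneg hρ0 (by linarith), sum_bern _,
    bern_mul_exp_le (by linarith) (by linarith) ?_, bern_mul_exp_le (by linarith) (by linarith) ?_,
    ?_, ?_, ?_, ?_⟩
  · rw [neg_neg, hexp, ← hmp]
    apply le_of_eq; field_simp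
  · rw [Real.exp_neg, hexp, ← hmq]
    apply le_of_eq; field_simp
  · refine (sum_bern_mul_llr_le (by linarith) hup).trans ?_
    linarith
  · refine (sum_bern_mul_llr_le (by linarith) (by linarith)).trans ?_
    linarith
  · exact (variance_bern_llr_le hρ0 (by linarith) hup).trans (hvar _ _ (by ring) hd1)
  · exact (variance_bern_llr_le hρ0 (by linarith) (by linarith)).trans (hvar _ _ rfl hd2)

/-! ### Testing the label of one node -/

/-- The block model with connection probabilities `p` within and `q` between communities. -/
noncomputable def blockMatrix {n k : ℕ} (θ : Fin n → ℝ) (p q : ℝ) (z : Fin n → Fin k) :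
    Matrix (Fin n) (Fin n) ℝ :=
  fun i j => if i = j then 0 else θ i * θ j * (if z i = z j then p else q)

theorem prob_eq_prod_bern {n : ℕ} (P : Matrix (Fin n) (Fin n) ℝ) (A : Adjacency n) :
    prob P A = ∏ e : Pair n, bern (P e.1.1 e.1.2) (A e) := rfl

/-- A function of the pairs that contain `i`, summed over these pairs, is summed over their other
ends. -/
theorem sum_pair_le {n : ℕ} (i : Fin n) (g : Fin n → ℝ) (hg : ∀ j, 0 ≤ g j) :
    ∑ e : Pair n, (if e.1.1 = i then g e.1.2 else if e.1.2 = i then g e.1.1 else 0) ≤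
      ∑ j ∈ Finset.univ.erase i, g j := by
  set o : Pair n → Fin n := fun e => if e.1.1 = i then e.1.2 else e.1.1 with ho
  set s : Finset (Pair n) := Finset.univ.filter fun e => e.1.1 = i ∨ e.1.2 = i with hs
  have h1 : ∑ e : Pair n, (if e.1.1 = i then g e.1.2 else if e.1.2 = i then g e.1.1 else 0)
      = ∑ e ∈ s, g (o e) := by
    rw [hs, Finset.sum_filter]
    refine Finset.sum_congr rfl fun e _ => ?_
    by_cases h : e.1.1 = i
    · simp [ho, h]
    · simp [ho, h]
  have hinj : Set.InjOn o s := by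
    rintro ⟨⟨x, y⟩, hxy⟩ h ⟨⟨x', y'⟩, hxy'⟩ h' heq
    simp only [hs, Finset.coe_filter, Finset.mem_univ, true_and, Set.mem_ofPred_eq] at h h'
    simp only [ho] at heq hxy hxy'
    ext <;> simp only <;> split_ifs at heq <;> grind
  rw [h1, ← Finset.sum_image hinj]
  refine Finset.sum_le_sum_of_subset_of_nonneg ?_ fun j _ _ => hg j
  intro j hj
  rw [Finset.mem_image] at hj
  obtain ⟨⟨⟨x, y⟩, hxy⟩, h, rfl⟩ := hj
  simp only [hs, Finset.mem_filter, Finset.mem_univ, true_and] at h hxy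
  simp only [ho, Finset.mem_erase, Finset.mem_univ, and_true]
  split_ifs with hc
  · rintro rfl; rw [hc] at hxy; exact lt_irrefl _ hxy
  · exact hc

/-- The two labellings differ in the label of `i` only, which is `u` under `z` and `v` under `z'`.
The testing affinity of the two block models decays with the exponent `θ_i W (√p - √q)²`, where `W`
bounds the total weight of either community. -/
theorem exp_le_sum_min_prob {n k : ℕ} {θ : Fin n → ℝ} (hθ : ∀ i, 0 ≤ θ i) {p q ω K : ℝ}
    (hq : 0 < q) (hpq : q < p) (hK : p / q ≤ K) (hpω : ∀ i j, p * (θ i * θ j) ≤ ω)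
    (hω : ω ≤ 1 / 2) {z z' : Fin n → Fin k} {i : Fin n} {u v : Fin k} (huv : u ≠ v)
    (hzi : z i = u) (hzi' : z' i = v) (hzz : ∀ j, j ≠ i → z' j = z j) {W : ℝ}
    (hWu : ∑ j ∈ (Finset.univ.erase i).filter (fun j => z j = u), θ j ≤ W)
    (hWv : ∑ j ∈ (Finset.univ.erase i).filter (fun j => z j = v), θ j ≤ W)
    {η : ℝ} (hη : 0 < η) :
    Real.exp (-(θ i * W * (√p - √q) ^ 2 * (1 + 4 * ω + 2 * η * (4 * K + 8)) + 1 / (2 * η))) ≤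
      ∑ A : Adjacency n, min (prob (blockMatrix θ p q z) A) (prob (blockMatrix θ p q z') A) := by
  have hp : 0 < p := hq.trans hpq
  have hω0 : 0 ≤ ω := (mul_nonneg hp.le (mul_nonneg (hθ i) (hθ i))).trans (hpω i i)
  have hK0 : 0 ≤ K := (div_pos hp hq).le.trans hK
  have hin := klIn_nonneg hq hpq hω0
  have hout := klOut_nonneg hq hpq hω0
  have hadd := klIn_add_klOut (ω := ω) hp.le hq.le
  set D := (√p - √q) ^ 2 with hD
  have hD0 : 0 ≤ D := sq_nonneg _
  set κ := klIn p q ω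
  set κ' := klOut p q ω
  -- the contributions of the edge `ij` to the two divergences and to the variances
  set gX : Fin n → ℝ := fun j => θ i * θ j * (if z j = u then κ else if z j = v then κ' else 0)
    with hgX
  set gY : Fin n → ℝ := fun j => θ i * θ j * (if z j = u then κ' else if z j = v then κ else 0)
    with hgY
  set gV : Fin n → ℝ := fun j => θ i * θ j *
    (if z j = u then (2 * K + 4) * D else if z j = v then (2 * K + 4) * D else 0) with hgV
  let E : (Fin n → ℝ) → Pair n → ℝ := fun g e =>
    if e.1.1 = i then g e.1.2 else if e.1.2 = i then g e.1.1 else 0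
  have hnode : ∀ j, j ≠ i → ∃ r X Y : Bool → ℝ, (∀ x, 0 ≤ r x) ∧ ∑ x, r x = 1 ∧
      (∀ x, r x * Real.exp (-X x) ≤ bern (θ i * θ j * (if u = z j then p else q)) x) ∧
      (∀ x, r x * Real.exp (-Y x) ≤ bern (θ i * θ j * (if v = z j then p else q)) x) ∧
      ∑ x, r x * X x ≤ gX j ∧ ∑ x, r x * Y x ≤ gY j ∧
      ∑ x, r x * (X x - ∑ y, r y * X y) ^ 2 ≤ gV j ∧
      ∑ x, r x * (Y x - ∑ y, r y * Y y) ^ 2 ≤ gV j := by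
    intro j _
    have hu0 : 0 ≤ θ i * θ j := mul_nonneg (hθ i) (hθ j)
    obtain ⟨r, X, Y, h0, h1, hX, hY, hmX, hmY, hvX, hvY⟩ :=
      exists_edge_law hq hpq hK hu0 (hpω i j) hω
    by_cases hju : z j = u
    · have hjv : z j ≠ v := fun h => huv (hju.symm.trans h)
      have eX : gX j = θ i * θ j * κ := by simp [hgX, hju]
      have eY : gY j = θ i * θ j * κ' := by simp [hgY, hju]
      have eV : gV j = θ i * θ j * ((2 * K + 4) * D) := by simp [hgV, hju]
      rw [eX, eY, eV, if_pos hju.symm, if_neg hjv.symm]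
      exact ⟨r, X, Y, h0, h1, hX, hY, hmX, hmY, hvX, hvY⟩
    · by_cases hjv : z j = v
      · have eX : gX j = θ i * θ j * κ' := by simp [hgX, hjv, huv.symm]
        have eY : gY j = θ i * θ j * κ := by simp [hgY, hjv, huv.symm]
        have eV : gV j = θ i * θ j * ((2 * K + 4) * D) := by simp [hgV]; simp [hjv]
        rw [eX, eY, eV, if_neg (Ne.symm hju), if_pos hjv.symm]
        exact ⟨r, Y, X, h0, h1, hY, hX, hmY, hmX, hvY, hvX⟩
      · have hle : θ i * θ j * q ≤ 1 := by
          have h2 : θ i * θ j * q ≤ p * (θ i * θ j) := by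
            rw [mul_comm p]; gcongr
          linarith [hpω i j]
        refine ⟨bern (θ i * θ j * q), 0, 0, bern_nonneg (by positivity) hle, sum_bern _,
          ?_, ?_, ?_, ?_, ?_, ?_⟩ <;>
          simp [hgX, hgY, hgV, hju, hjv, Ne.symm hju, Ne.symm hjv]
  have hedge : ∀ e : Pair n, ∃ r X Y : Bool → ℝ, (∀ x, 0 ≤ r x) ∧ ∑ x, r x = 1 ∧
      (∀ x, r x * Real.exp (-X x) ≤ bern (blockMatrix θ p q z e.1.1 e.1.2) x) ∧
      (∀ x, r x * Real.exp (-Y x) ≤ bern (blockMatrix θ p q z' e.1.1 e.1.2) x) ∧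
      ∑ x, r x * X x ≤ E gX e ∧ ∑ x, r x * Y x ≤ E gY e ∧
      ∑ x, r x * (X x - ∑ y, r y * X y) ^ 2 ≤ E gV e ∧
      ∑ x, r x * (Y x - ∑ y, r y * Y y) ^ 2 ≤ E gV e := by
    rintro ⟨⟨x, y⟩, hxy⟩
    have hne : x ≠ y := ne_of_lt hxy
    simp only [E, blockMatrix, if_neg hne]
    by_cases hx : x = i
    · have hy : y ≠ i := fun h => hne (hx.trans h.symm)
      have h := hnode y hy
      simpa only [hx, if_true, hzi, hzi', hzz y hy] using h
    · by_cases hy : y = i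
      · have h := hnode x hx
        simp only [if_neg hx, hy, if_true, hzi, hzi', hzz x hx, mul_comm (θ x), eq_comm (a := z x)]
        exact h
      · have hu0 : 0 ≤ θ x * θ y := mul_nonneg (hθ x) (hθ y)
        have hle : θ x * θ y * (if z x = z y then p else q) ≤ 1 := by
          have h2 : θ x * θ y * (if z x = z y then p else q) ≤ p * (θ x * θ y) := by
            rw [mul_comm p]
            gcongr
            split_ifs <;> linarith
          linarith [hpω x y]
        have hge : 0 ≤ θ x * θ y * (if z x = z y then p else q) := by
          apply mul_nonneg hu0; split_ifs <;> linarith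
        refine ⟨bern (θ x * θ y * (if z x = z y then p else q)), 0, 0, bern_nonneg hge hle,
          sum_bern _, ?_, ?_, ?_, ?_, ?_, ?_⟩ <;> simp [hx, hy, hzz x hx, hzz y hy]
  choose r X Y h0 h1 hX hY hmX hmY hvX hvY using hedge
  -- summing the contributions of all edges
  have hsum : ∀ c c' : ℝ, 0 ≤ c → 0 ≤ c' →
      ∑ e, E (fun j => θ i * θ j * (if z j = u then c else if z j = v then c' else 0)) e ≤
        θ i * W * (c + c') := by
    intro c c' hc hc'
    refine (sum_pair_le i (fun j => θ i * θ j * (if z j = u then c else if z j = v then c' else 0))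
      fun j => ?_).trans ?_
    · apply mul_nonneg (mul_nonneg (hθ i) (hθ j)); split_ifs <;> first | assumption | exact le_rfl
    · have hsplit : ∀ j, θ i * θ j * (if z j = u then c else if z j = v then c' else 0) =
          θ i * c * (if z j = u then θ j else 0) + θ i * c' * (if z j = v then θ j else 0) := by
        intro j
        by_cases hju : z j = u
        · simp [hju, huv]; ring
        · simp [hju]; split_ifs <;> ring
      simp_rw [hsplit]
      rw [Finset.sum_add_distrib, ← Finset.mul_sum, ← Finset.mul_sum, ← Finset.sum_filter,
        ← Finset.sum_filter]
      have h2 := mul_le_mul_of_nonneg_left hWu (mul_nonneg (hθ i) hc)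
      have h3 := mul_le_mul_of_nonneg_left hWv (mul_nonneg (hθ i) hc')
      linarith
  have hmX' := (Finset.sum_le_sum fun e _ => hmX e).trans (hsum κ κ' hin hout)
  have hmY' := (Finset.sum_le_sum fun e _ => hmY e).trans (hsum κ' κ hout hin)
  have hKD : 0 ≤ (2 * K + 4) * D := by positivity
  have hvX' := (Finset.sum_le_sum fun e _ => hvX e).trans (hsum _ _ hKD hKD)
  have hvY' := (Finset.sum_le_sum fun e _ => hvY e).trans (hsum _ _ hKD hKD)
  rw [add_comm κ' κ] at hmY'
  have hfin := exp_le_sum_min_prod _ _ r X Y h0 h1 hX hY hη hmX' hmY' hvX' hvY'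
  rw [hadd] at hfin
  refine le_trans (Real.exp_le_exp.2 (le_of_eq ?_)) hfin
  ring

/-! ### From the minimax risk to testing single labels -/

/-- When only the labels of the nodes in `T` are unknown, and `T` is smaller than each of the known
parts of the communities, the permutation in the loss is of no help: one fixed relabelling `φ` of
the estimate may be used for all `z`, at the price of a factor `2`. -/
theorem exists_relabel_le_loss {n k : ℕ} {z0 : Fin n → Fin k} {T : Finset (Fin n)}
    (hT : ∀ w, T.card ≤ (Tᶜ.filter fun i => z0 i = w).card) (zhat : Fin n → Fin k) :
    ∃ φ : Fin n → Fin k, ∀ z : Fin n → Fin k, (∀ i, i ∉ T → z i = z0 i) →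
      1 / (2 * (n : ℝ)) * ((T.filter fun i => φ i ≠ z i).card : ℝ) ≤ loss zhat z := by
  set d : Equiv.Perm (Fin k) → ℕ := fun π => (Tᶜ.filter fun i => zhat i ≠ π (z0 i)).card with hd
  obtain ⟨π₀, -, hmin⟩ := Finset.exists_min_image Finset.univ d ⟨1, Finset.mem_univ _⟩
  refine ⟨fun i => π₀.symm (zhat i), fun z hz => ?_⟩
  obtain ⟨π, hπ⟩ := exists_eq_ciInf_of_finite (f := fun π : Equiv.Perm (Fin k) =>
    hammingDist zhat (π ∘ z))
  have key : (T.filter fun i => π₀.symm (zhat i) ≠ z i).card ≤ 2 * hammingDist zhat (π ∘ z) := by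
    unfold hammingDist
    by_cases h : π = π₀
    · have hsub : (T.filter fun i => π₀.symm (zhat i) ≠ z i) ⊆
          Finset.univ.filter fun i => zhat i ≠ (π ∘ z) i := by
        intro i hi
        rw [Finset.mem_filter] at hi
        refine Finset.mem_filter.2 ⟨Finset.mem_univ _, fun hc => hi.2 ?_⟩
        rw [hc, h]; simp
      have := Finset.card_le_card hsub
      omega
    · obtain ⟨w, hw⟩ : ∃ w, π w ≠ π₀ w := by
        by_contra hc; push Not at hc; exact h (Equiv.ext hc)
      -- on the known part of community `w`, the estimate disagrees with `π` or with `π₀`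
      have hsub : (Tᶜ.filter fun i => z0 i = w) ⊆
          (Tᶜ.filter fun i => zhat i ≠ π (z0 i)) ∪ (Tᶜ.filter fun i => zhat i ≠ π₀ (z0 i)) := by
        intro i hi
        rw [Finset.mem_filter] at hi
        rw [Finset.mem_union, Finset.mem_filter, Finset.mem_filter, hi.2]
        by_cases hc : zhat i = π w
        · exact Or.inr ⟨hi.1, hc ▸ hw⟩
        · exact Or.inl ⟨hi.1, hc⟩
      have h1 := (Finset.card_le_card hsub).trans (Finset.card_union_le _ _)
      have h2 : d π₀ ≤ d π := hmin π (Finset.mem_univ _)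
      have h3 : d π ≤ (Finset.univ.filter fun i => zhat i ≠ (π ∘ z) i).card := by
        refine Finset.card_le_card fun i hi => ?_
        rw [Finset.mem_filter, Finset.mem_compl] at hi
        refine Finset.mem_filter.2 ⟨Finset.mem_univ _, ?_⟩
        rw [Function.comp_apply, hz i hi.1]
        exact hi.2
      have h4 : (T.filter fun i => π₀.symm (zhat i) ≠ z i).card ≤ T.card :=
        Finset.card_filter_le _ _
      have h5 := hT w
      simp only [hd] at h2 h3
      omega
  have hl : loss zhat z = (hammingDist zhat (π ∘ z) : ℝ) / n := by
    unfold loss; rw [← hπ]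
  rw [hl]
  have key' : ((T.filter fun i => π₀.symm (zhat i) ≠ z i).card : ℝ) ≤
      2 * hammingDist zhat (π ∘ z) := by exact_mod_cast key
  calc 1 / (2 * (n : ℝ)) * ((T.filter fun i => π₀.symm (zhat i) ≠ z i).card : ℝ)
      ≤ 1 / (2 * (n : ℝ)) * (2 * hammingDist zhat (π ∘ z)) := by gcongr
    _ = (hammingDist zhat (π ∘ z) : ℝ) / n := by
        rcases Nat.eq_zero_or_pos n with h | h
        · simp [h]
        · field_simp

/-- The labelling that has label `u` on `S`, label `v` on `T \ S`, and agrees with `z0` off `T`. -/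
def splitLabel {n k : ℕ} (z0 : Fin n → Fin k) (T : Finset (Fin n)) (u v : Fin k)
    (S : Finset (Fin n)) : Fin n → Fin k :=
  fun i => if i ∈ T then (if i ∈ S then u else v) else z0 i

theorem prob_nonneg {n : ℕ} {P : Matrix (Fin n) (Fin n) ℝ} (hP : ∀ i j, P i j ∈ Set.Icc (0 : ℝ) 1)
    (A : Adjacency n) : 0 ≤ prob P A := by
  rw [prob_eq_prod_bern]
  exact Finset.prod_nonneg fun e _ => bern_nonneg (hP _ _).1 (hP _ _).2 _

theorem choose_two_mul_add_one_le (a : ℕ) :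
    (2 * a + 1).choose a ≤ 2 * (2 * a).choose a ∧
      (2 * a + 1).choose (a + 1) ≤ 2 * (2 * a).choose a := by
  have h1 : (2 * a + 1).choose (a + 1) ≤ 2 * (2 * a).choose a := by
    rw [Nat.choose_succ_succ']
    have := Nat.choose_le_centralBinom (a + 1) a
    rw [Nat.centralBinom] at this
    omega
  exact ⟨(Nat.choose_symm_half a).symm.trans_le h1, h1⟩

/-- The Bayes risk for the uniform prior on the splits of `T` into parts of sizes `a` and `a + 1`.
Given all labels but that of `i`, both labels of `i` remain possible with a probability bounded
below, and the error in testing between them is the affinity of the two laws. -/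
theorem exists_le_risk {n k a : ℕ} {z0 : Fin n → Fin k} {T : Finset (Fin n)}
    (hTcard : T.card = 2 * a + 1)
    (hT : ∀ w, T.card ≤ (Tᶜ.filter fun i => z0 i = w).card) {u v : Fin k} (huv : u ≠ v)
    (P : Finset (Fin n) → Matrix (Fin n) (Fin n) ℝ) (hP : ∀ S i j, P S i j ∈ Set.Icc (0 : ℝ) 1)
    {f : Fin n → ℝ} (hf : ∀ i, 0 ≤ f i)
    (hmin : ∀ i ∈ T, ∀ S ∈ Finset.powersetCard a (T.erase i),
      f i ≤ ∑ A : Adjacency n, min (prob (P S) A) (prob (P (insert i S)) A))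
    (zhat : Adjacency n → Fin n → Fin k) :
    ∃ S ⊆ T, (S.card = a ∨ S.card = a + 1) ∧
      1 / (8 * (n : ℝ)) * ∑ i ∈ T, f i ≤ risk zhat (splitLabel z0 T u v S) (P S) := by
  have hnpos : 0 < n := by
    have h1 : T.card ≤ n := by simpa using Finset.card_le_univ T
    omega
  choose φ hφ using fun A => exists_relabel_le_loss hT (zhat A)
  set z := splitLabel z0 T u v with hz
  have hz0 : ∀ S i, i ∉ T → z S i = z0 i := fun S i hi => by simp [hz, splitLabel, hi]
  set err : Fin n → Finset (Fin n) → ℝ := fun i S =>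
    ∑ A, prob (P S) A * (if φ A i ≠ z S i then 1 else 0) with herr
  have herr0 : ∀ i S, 0 ≤ err i S := fun i S => Finset.sum_nonneg fun A _ =>
    mul_nonneg (prob_nonneg (hP S) A) (by split_ifs <;> norm_num)
  have hrisk : ∀ S, ∑ i ∈ T, err i S ≤ 2 * n * risk zhat (z S) (P S) := by
    intro S
    simp only [herr, risk]
    rw [Finset.sum_comm, Finset.mul_sum]
    refine Finset.sum_le_sum fun A _ => ?_
    rw [← Finset.mul_sum, ← Finset.sum_filter, Finset.sum_const, nsmul_eq_mul, mul_one]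
    have h1 := mul_le_mul_of_nonneg_left (hφ A (z S) (hz0 S)) (prob_nonneg (hP S) A)
    have h2 : (0 : ℝ) < n := by exact_mod_cast hnpos
    calc _ = 2 * n * (prob (P S) A *
          (1 / (2 * (n : ℝ)) * ((T.filter fun i => φ A i ≠ z S i).card : ℝ))) := by field_simp
      _ ≤ _ := by gcongr
  -- the two-point testing problem for the label of `i`
  have htest : ∀ i ∈ T, ∀ S ∈ Finset.powersetCard a (T.erase i),
      f i ≤ err i S + err i (insert i S) := by
    intro i hi S hS
    refine (hmin i hi S hS).trans ?_
    simp only [herr]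
    rw [← Finset.sum_add_distrib]
    refine Finset.sum_le_sum fun A _ => ?_
    have hiS : i ∉ S := fun h =>
      Finset.notMem_erase i T ((Finset.mem_powersetCard.1 hS).1 h)
    have h1 : z S i = v := by simp [hz, splitLabel, hi, hiS]
    have h2 : z (insert i S) i = u := by simp [hz, splitLabel, hi]
    rw [h1, h2]
    have hp1 := prob_nonneg (hP S) A
    have hp2 := prob_nonneg (hP (insert i S)) A
    by_cases hc : φ A i = v
    · have hc' : φ A i ≠ u := fun h => huv (h.symm.trans hc)
      rw [if_pos hc', if_neg (by simpa using hc)]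
      linarith [min_le_right (prob (P S) A) (prob (P (insert i S)) A)]
    · rw [if_pos hc]
      have : 0 ≤ prob (P (insert i S)) A * (if φ A i ≠ u then 1 else 0) :=
        mul_nonneg hp2 (by split_ifs <;> norm_num)
      linarith [min_le_left (prob (P S) A) (prob (P (insert i S)) A)]
  set N : ℕ := (2 * a).choose a with hN
  have hsum : ∀ i ∈ T, (N : ℝ) * f i ≤
      ∑ S ∈ Finset.powersetCard a T, err i S + ∑ S ∈ Finset.powersetCard (a + 1) T, err i S := by
    intro i hi
    have hcard : (Finset.powersetCard a (T.erase i)).card = N := by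
      rw [Finset.card_powersetCard, Finset.card_erase_of_mem hi, hTcard]; rfl
    have hnot : ∀ S ∈ Finset.powersetCard a (T.erase i), i ∉ S := fun S hS h =>
      Finset.notMem_erase i T ((Finset.mem_powersetCard.1 hS).1 h)
    have h1 : ∑ S ∈ Finset.powersetCard a (T.erase i), err i S ≤
        ∑ S ∈ Finset.powersetCard a T, err i S :=
      Finset.sum_le_sum_of_subset_of_nonneg
        (Finset.powersetCard_mono (Finset.erase_subset _ _)) fun S _ _ => herr0 i S
    have hinj : Set.InjOn (insert i)
        (Finset.powersetCard a (T.erase i) : Set (Finset (Fin n))) := by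
      intro S hS S' hS' h
      rw [← Finset.erase_insert (hnot S hS), ← Finset.erase_insert (hnot S' hS'), h]
    have h2 : ∑ S ∈ Finset.powersetCard a (T.erase i), err i (insert i S) ≤
        ∑ S ∈ Finset.powersetCard (a + 1) T, err i S := by
      rw [← Finset.sum_image (g := insert i) (f := fun S => err i S) hinj]
      refine Finset.sum_le_sum_of_subset_of_nonneg ?_ fun S _ _ => herr0 i S
      intro S' hS'
      obtain ⟨S, hS, rfl⟩ := Finset.mem_image.1 hS'
      have hS1 := Finset.mem_powersetCard.1 hS
      rw [Finset.mem_powersetCard, Finset.card_insert_of_notMem (hnot S hS), hS1.2]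
      exact ⟨Finset.insert_subset hi (hS1.1.trans (Finset.erase_subset _ _)), rfl⟩
    have h3 := Finset.sum_le_sum fun S hS => htest i hi S hS
    rw [Finset.sum_const, hcard, nsmul_eq_mul, Finset.sum_add_distrib] at h3
    linarith
  set x : ℝ := 1 / (8 * (n : ℝ)) * ∑ i ∈ T, f i with hx
  have hx0 : 0 ≤ x := mul_nonneg (by positivity) (Finset.sum_nonneg fun i _ => hf i)
  by_contra hcon
  push Not at hcon
  have hn' : (0 : ℝ) < n := by exact_mod_cast hnpos
  have hlt : ∀ b, (b = a ∨ b = a + 1) → ∑ S ∈ Finset.powersetCard b T, ∑ i ∈ T, err i S <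
      2 * N * (2 * n * x) := by
    intro b hb
    have hne : (Finset.powersetCard b T).Nonempty := by
      rw [Finset.powersetCard_nonempty]; omega
    have h1 : ∑ S ∈ Finset.powersetCard b T, ∑ i ∈ T, err i S <
        ∑ _S ∈ Finset.powersetCard b T, 2 * n * x := by
      refine Finset.sum_lt_sum_of_nonempty hne fun S hS => (hrisk S).trans_lt ?_
      rw [Finset.mem_powersetCard] at hS
      have h2 := hcon S hS.1 (by rcases hb with rfl | rfl <;> simp [hS.2])
      gcongr
    rw [Finset.sum_const, nsmul_eq_mul, Finset.card_powersetCard, hTcard] at h1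
    have h3 : (((2 * a + 1).choose b : ℕ) : ℝ) ≤ 2 * N := by
      have h4 := choose_two_mul_add_one_le a
      rcases hb with rfl | rfl
      · exact_mod_cast h4.1
      · exact_mod_cast h4.2
    refine h1.trans_le ?_
    gcongr
  have h1 := hlt a (Or.inl rfl)
  have h2 := hlt (a + 1) (Or.inr rfl)
  have h3 := Finset.sum_le_sum hsum
  rw [← Finset.mul_sum, Finset.sum_add_distrib, Finset.sum_comm,
    Finset.sum_comm (s := T) (t := Finset.powersetCard (a + 1) T)] at h3
  have h4 : 2 * N * (2 * n * x) + 2 * N * (2 * n * x) = N * ∑ i ∈ T, f i := by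
    rw [hx]; field_simp; ring
  linarith

/-! ### Least favourable labellings -/

/-- The number of nodes that community `w` gives up: `a` if `w = u`, another `a` if `w = v`, and one
more if `w = w₀`. -/
def giveUp {k : ℕ} (a : ℕ) (u v w₀ w : Fin k) : ℕ :=
  (if w = u then a else 0) + (if w = v then a else 0) + (if w = w₀ then 1 else 0)

theorem giveUp_le {k a : ℕ} {u v : Fin k} (huv : u ≠ v) (w₀ w : Fin k) :
    giveUp a u v w₀ w ≤ a + 1 := by
  unfold giveUp
  by_cases h1 : w = u <;> by_cases h2 : w = v <;> simp [h1, h2] <;> grind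

theorem sum_giveUp {k : ℕ} (a : ℕ) (u v w₀ : Fin k) :
    ∑ w, giveUp a u v w₀ w = 2 * a + 1 := by
  simp only [giveUp, Finset.sum_add_distrib, Finset.sum_ite_eq', Finset.mem_univ, if_true]
  omega

/-- The nodes that get label `w` when `T` is split into `S` (label `u`) and `T \ S` (label `v`). -/
def splitPart {n k : ℕ} (T S : Finset (Fin n)) (u v w : Fin k) : Finset (Fin n) :=
  if w = u then S else if w = v then T \ S else ∅

theorem splitPart_subset {n k : ℕ} {T S : Finset (Fin n)} (hS : S ⊆ T) (u v w : Fin k) :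
    splitPart T S u v w ⊆ T := by
  unfold splitPart
  split_ifs
  · exact hS
  · exact Finset.sdiff_subset
  · exact Finset.empty_subset _

theorem sum_splitLabel {n k : ℕ} (z0 : Fin n → Fin k) {T S : Finset (Fin n)} (hS : S ⊆ T)
    {u v : Fin k} (huv : u ≠ v) (w : Fin k) (g : Fin n → ℝ) :
    ∑ i ∈ Finset.univ.filter (fun i => splitLabel z0 T u v S i = w), g i =
      ∑ i ∈ Tᶜ.filter (fun i => z0 i = w), g i + ∑ i ∈ splitPart T S u v w, g i := by
  rw [← Finset.sum_union]
  · refine Finset.sum_congr ?_ fun _ _ => rfl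
    ext i
    have := @hS i
    rw [Finset.mem_union, Finset.mem_filter, Finset.mem_filter, Finset.mem_compl]
    unfold splitLabel splitPart
    grind
  · rw [Finset.disjoint_left]
    intro i hi hi'
    exact Finset.mem_compl.1 (Finset.mem_filter.1 hi).1 (splitPart_subset hS u v w hi')

/-- The sizes of the parts of a nearly even split, compared with the numbers of nodes given up. -/
theorem card_splitPart {n k a : ℕ} {T S : Finset (Fin n)} (hT : T.card = 2 * a + 1) (hS : S ⊆ T)
    (hSc : S.card = a ∨ S.card = a + 1) {u v : Fin k} (huv : u ≠ v) (w₀ w : Fin k) :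
    giveUp a u v w₀ w ≤ (splitPart T S u v w).card + (if w = w₀ then 1 else 0) ∧
      (splitPart T S u v w).card ≤
        giveUp a u v w₀ w + (if (w = u ∨ w = v) ∧ w ≠ w₀ then 1 else 0) := by
  have h1 : (T \ S).card = 2 * a + 1 - S.card := by rw [Finset.card_sdiff_of_subset hS, hT]
  unfold giveUp splitPart
  by_cases hu : w = u
  · have hv : w ≠ v := fun h => huv (hu.symm.trans h)
    simp only [hu, if_true, huv, if_false, true_or, true_and]
    split_ifs <;> omega
  · by_cases hv : w = v
    · simp only [hv, huv.symm, if_true, if_false, or_true, true_and]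
      split_ifs <;> omega
    · simp only [hu, hv, if_false, false_or, false_and, Finset.card_empty]
      split_ifs <;> omega

/-- The labels of the `2a + 1` nodes with the smallest weights may be split nearly evenly, in any
way, between the labels `u` and `v`: when the other labels are chosen well, all communities keep
their sizes up to one node, and averages stay in `[1 - δ, 1 + δ]`. To this end the nodes of `T`
change places with nodes of small weight in the communities `u`, `v` and `w₀`. -/
theorem exists_base_label {n k a : ℕ} {θ : Fin n → ℝ} (hθ : ∀ i, 0 ≤ θ i) {δ : ℝ} (hδ : 0 < δ)
    {zs : Fin n → Fin k}
    (havg : ∀ w, commAvg θ zs w ∈ Set.Ioo (1 - δ / 4) (1 + δ / 4))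
    (hsize : ∀ w, (3 * a + 2) * (1 + δ) ≤ 3 / 4 * δ * commSize zs w)
    {u v : Fin k} (huv : u ≠ v) (w₀ : Fin k) :
    ∃ (T : Finset (Fin n)) (z0 : Fin n → Fin k), T.card = 2 * a + 1 ∧
      (∀ i ∈ T, ∀ j ∈ Finset.univ \ T, θ i ≤ θ j) ∧
      (∀ w, T.card ≤ (Tᶜ.filter fun i => z0 i = w).card) ∧
      ∀ S ⊆ T, (S.card = a ∨ S.card = a + 1) → ∀ w,
        commAvg θ (splitLabel z0 T u v S) w ∈ Set.Icc (1 - δ) (1 + δ) ∧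
        commSize zs w ≤ commSize (splitLabel z0 T u v S) w + (if w = w₀ then 1 else 0) ∧
        commSize (splitLabel z0 T u v S) w ≤
          commSize zs w + (if (w = u ∨ w = v) ∧ w ≠ w₀ then 1 else 0) := by
  set C : Fin k → Finset (Fin n) := fun w => Finset.univ.filter fun i => zs i = w with hC
  have hCcard : ∀ w, (C w).card = commSize zs w := fun w => rfl
  have hbig : ∀ w, 3 * a + 2 ≤ commSize zs w := by
    intro w
    have h := hsize w
    by_contra hc
    push Not at hc
    have h1 : (commSize zs w : ℝ) ≤ 3 * a + 2 := by exact_mod_cast hc.le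
    nlinarith [mul_le_mul_of_nonneg_left h1 hδ.le, mul_nonneg hδ.le (Nat.cast_nonneg (α := ℝ) a),
      Nat.cast_nonneg (α := ℝ) a]
  have hcle := giveUp_le (a := a) huv w₀
  set c := giveUp a u v w₀ with hc
  choose F hFC hFcard hFmin using fun w => exists_subset_smallest θ (C w) (c := c w)
    (by rw [hCcard]; have := hbig w; have := hcle w; omega)
  set T0 : Finset (Fin n) := Finset.univ.filter fun i => i ∈ F (zs i) with hT0
  have hT0F : ∀ w, T0.filter (fun i => zs i = w) = F w := by
    intro w
    ext i
    simp only [hT0, Finset.mem_filter, Finset.mem_univ, true_and]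
    constructor
    · rintro ⟨h1, rfl⟩; exact h1
    · intro h
      have h2 : zs i = w := by simpa [hC] using hFC w h
      exact ⟨h2 ▸ h, h2⟩
  have hT0card : T0.card = 2 * a + 1 := by
    rw [Finset.card_eq_sum_card_fiberwise (f := zs) (t := Finset.univ)
      (fun _ _ => Finset.mem_coe.2 (Finset.mem_univ _)), ← sum_giveUp a u v w₀]
    exact Finset.sum_congr rfl fun w _ => by rw [hT0F, hFcard]
  obtain ⟨T, -, hTcard, hTmin⟩ := exists_subset_smallest θ Finset.univ (c := 2 * a + 1)
    (hT0card ▸ Finset.card_le_card (Finset.subset_univ T0))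
  have hcards : (T0 \ T).card = (T \ T0).card := by
    have h1 := Finset.card_sdiff_add_card_inter T0 T
    have h2 := Finset.card_sdiff_add_card_inter T T0
    rw [Finset.inter_comm] at h2
    omega
  -- a bijection along which the nodes change places
  obtain ⟨f, hf⟩ : ∃ f : Fin n → Fin n,
      Set.BijOn f (T0 \ T : Finset (Fin n)) (T \ T0 : Finset (Fin n)) := by
    rcases isEmpty_or_nonempty (Fin n) with h | h
    · refine ⟨id, ?_⟩
      have h1 : T0 \ T = ∅ := Finset.eq_empty_of_isEmpty _
      have h2 : T \ T0 = ∅ := Finset.eq_empty_of_isEmpty _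
      rw [h1, h2]; exact Set.bijOn_id _
    · exact (Finset.finite_toSet _).exists_bijOn_of_encard_eq (by
        rw [Set.encard_coe_eq_coe_finsetCard, Set.encard_coe_eq_coe_finsetCard, hcards])
  set z0 : Fin n → Fin k := fun i => if i ∈ T0 \ T then zs (f i) else zs i with hz0
  -- the part of a community outside `T`, in terms of what stays and what is moved in
  have hD : ∀ w (g : Fin n → ℝ), ∑ i ∈ Tᶜ.filter (fun i => z0 i = w), g i =
      ∑ i ∈ (Tᶜ \ T0).filter (fun i => zs i = w), g i +
        ∑ i ∈ (T0 \ T).filter (fun i => zs (f i) = w), g i := by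
    intro w g
    rw [← Finset.sum_union]
    · refine Finset.sum_congr ?_ fun _ _ => rfl
      ext i
      simp only [hz0, Finset.mem_union, Finset.mem_filter, Finset.mem_sdiff, Finset.mem_compl]
      by_cases h1 : i ∈ T <;> by_cases h2 : i ∈ T0 <;> simp [h1, h2]
    · rw [Finset.disjoint_left]
      intro i hi hi'
      simp only [Finset.mem_filter, Finset.mem_sdiff] at hi hi'
      exact hi.1.2 hi'.1.1
  have hCF : ∀ w (g : Fin n → ℝ), ∑ i ∈ C w, g i =
      ∑ i ∈ (Tᶜ \ T0).filter (fun i => zs i = w), g i +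
        ∑ i ∈ (T \ T0).filter (fun i => zs i = w), g i + ∑ i ∈ F w, g i := by
    intro w g
    rw [← hT0F w, Finset.sum_filter, Finset.sum_filter, Finset.sum_filter, Finset.sum_filter,
      ← Finset.sum_union, ← Finset.sum_union]
    · refine Finset.sum_congr ?_ fun _ _ => rfl
      ext i
      simp only [Finset.mem_univ, Finset.mem_union, Finset.mem_sdiff, Finset.mem_compl]
      tauto
    · rw [Finset.disjoint_left]; intro i hi
      simp only [Finset.mem_union, Finset.mem_sdiff] at hi; tauto
    · rw [Finset.disjoint_left]; intro i hi
      simp only [Finset.mem_sdiff, Finset.mem_compl] at hi ⊢; tauto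
  have hbij : ∀ w (g : Fin n → ℝ), ∑ i ∈ (T0 \ T).filter (fun i => zs (f i) = w), g (f i) =
      ∑ i ∈ (T \ T0).filter (fun i => zs i = w), g i := by
    intro w g
    rw [Finset.sum_filter, Finset.sum_filter]
    exact Finset.sum_nbij f (fun i hi => Finset.mem_coe.1 (hf.mapsTo (Finset.mem_coe.2 hi)))
      hf.injOn hf.surjOn fun _ _ => rfl
  have hDcard : ∀ w, (Tᶜ.filter fun i => z0 i = w).card + c w = commSize zs w := by
    intro w
    have h1 := hD w (fun _ => 1)
    have h2 := hCF w (fun _ => 1)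
    have h3 := hbij w (fun _ => 1)
    rw [h3] at h1
    rw [← h1] at h2
    simp only [Finset.sum_const, nsmul_eq_mul, mul_one] at h2
    rw [hFcard, hCcard] at h2
    exact_mod_cast h2.symm
  have hDlow : ∀ w, ∑ i ∈ C w, θ i - ∑ i ∈ F w, θ i ≤ ∑ i ∈ Tᶜ.filter (fun i => z0 i = w), θ i := by
    intro w
    rw [hD, hCF w, ← hbij w]
    have : ∑ i ∈ (T0 \ T).filter (fun i => zs (f i) = w), θ (f i) ≤
        ∑ i ∈ (T0 \ T).filter (fun i => zs (f i) = w), θ i := by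
      refine Finset.sum_le_sum fun i hi => ?_
      have hi' := (Finset.mem_filter.1 hi).1
      have h1 := Finset.mem_sdiff.1 (Finset.mem_coe.1 (hf.mapsTo (Finset.mem_coe.2 hi')))
      exact hTmin _ h1.1 i (Finset.mem_sdiff.2 ⟨Finset.mem_univ _, (Finset.mem_sdiff.1 hi').2⟩)
    linarith
  have hDup : ∀ w, ∑ i ∈ Tᶜ.filter (fun i => z0 i = w), θ i ≤
      ∑ i ∈ C w, θ i - ∑ i ∈ F w, θ i + ∑ i ∈ T0, θ i := by
    intro w
    rw [hD, hCF w]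
    have h1 : ∑ i ∈ (T0 \ T).filter (fun i => zs (f i) = w), θ i ≤ ∑ i ∈ T0, θ i :=
      Finset.sum_le_sum_of_subset_of_nonneg
        ((Finset.filter_subset _ _).trans Finset.sdiff_subset) fun i _ _ => hθ i
    have h2 : 0 ≤ ∑ i ∈ (T \ T0).filter (fun i => zs i = w), θ i :=
      Finset.sum_nonneg fun i _ => hθ i
    linarith
  have hspos : ∀ w, (0 : ℝ) < commSize zs w := by
    intro w; have := hbig w; exact_mod_cast (by omega : 0 < commSize zs w)
  have hClow : ∀ w, commSize zs w * (1 - δ / 4) ≤ ∑ i ∈ C w, θ i := fun w => by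
    have := (lt_div_iff₀ (hspos w)).1 (havg w).1
    rw [mul_comm]; exact this.le
  have hCup : ∀ w, ∑ i ∈ C w, θ i ≤ commSize zs w * (1 + δ / 4) := fun w => by
    have := (div_lt_iff₀ (hspos w)).1 (havg w).2
    rw [mul_comm]; exact this.le
  have hFup : ∀ w, ∑ i ∈ F w, θ i ≤ c w * (1 + δ / 4) := by
    intro w
    have h1 := card_mul_sum_le_of_smallest θ (hFC w) (hFmin w)
    rw [hFcard, hCcard] at h1
    have h2 := mul_le_mul_of_nonneg_left (hCup w) (Nat.cast_nonneg (α := ℝ) (c w))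
    have h3 := h1.trans h2
    have h4 : (commSize zs w : ℝ) * ∑ i ∈ F w, θ i ≤ commSize zs w * (c w * (1 + δ / 4)) := by
      linarith
    exact le_of_mul_le_mul_left h4 (hspos w)
  have hT0up : ∑ i ∈ T0, θ i ≤ (2 * a + 1) * (1 + δ / 4) := by
    rw [← Finset.sum_fiberwise T0 zs]
    have h1 : ∀ w ∈ Finset.univ, ∑ i ∈ T0.filter (fun i => zs i = w), θ i ≤ c w * (1 + δ / 4) := by
      intro w _; rw [hT0F]; exact hFup w
    refine (Finset.sum_le_sum h1).trans ?_
    rw [← Finset.sum_mul, ← Nat.cast_sum, hc, sum_giveUp]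
    push_cast; exact le_rfl
  -- the nodes of `T`, having the smallest weights of all, have weights of at most `1 + δ`
  have hTmax : ∀ i ∈ T, θ i ≤ 1 + δ := by
    intro i hi
    by_contra hcon
    push Not at hcon
    have h1 : ∑ _j ∈ C u \ T, (1 + δ) ≤ ∑ j ∈ C u, θ j := by
      refine (Finset.sum_le_sum fun j hj => ?_).trans
        (Finset.sum_le_sum_of_subset_of_nonneg Finset.sdiff_subset fun j _ _ => hθ j)
      exact hcon.le.trans (hTmin i hi j
        (Finset.mem_sdiff.2 ⟨Finset.mem_univ _, (Finset.mem_sdiff.1 hj).2⟩))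
    rw [Finset.sum_const, nsmul_eq_mul] at h1
    have h2 : (commSize zs u : ℝ) ≤ (C u \ T).card + (2 * a + 1) := by
      have h3 := Finset.card_le_card_sdiff_add_card (s := C u) (t := T)
      rw [hTcard, hCcard] at h3
      exact_mod_cast h3
    have h4 := mul_le_mul_of_nonneg_right h2 (by linarith : (0 : ℝ) ≤ 1 + δ)
    have h5 := hCup u
    have h6 := hsize u
    have h7 := mul_nonneg hδ.le (Nat.cast_nonneg (α := ℝ) a)
    have h8 := Nat.cast_nonneg (α := ℝ) a
    linarith
  refine ⟨T, z0, hTcard, hTmin, fun w => ?_, fun S hS hSc w => ?_⟩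
  · have h1 := hDcard w
    have h2 := hcle w
    have h3 := hbig w
    omega
  · have hpart := card_splitPart hTcard hS hSc huv w₀ w
    rw [← hc] at hpart
    have hN : commSize (splitLabel z0 T u v S) w + c w =
        commSize zs w + (splitPart T S u v w).card := by
      have h1 := sum_splitLabel z0 hS huv w (fun _ => (1 : ℝ))
      simp only [Finset.sum_const, nsmul_eq_mul, mul_one] at h1
      have h2 := hDcard w
      have h3 : commSize (splitLabel z0 T u v S) w =
        (Tᶜ.filter fun i => z0 i = w).card + (splitPart T S u v w).card := by exact_mod_cast h1
      omega
    have hsz1 : commSize zs w ≤ commSize (splitLabel z0 T u v S) w + (if w = w₀ then 1 else 0) := by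
      omega
    have hsz2 : commSize (splitLabel z0 T u v S) w ≤
          commSize zs w + (if (w = u ∨ w = v) ∧ w ≠ w₀ then 1 else 0) := by omega
    refine ⟨?_, hsz1, hsz2⟩
    have hle1 : (if w = w₀ then 1 else 0) ≤ 1 := by split_ifs <;> norm_num
    have hle2 : (if (w = u ∨ w = v) ∧ w ≠ w₀ then 1 else 0) ≤ 1 := by split_ifs <;> norm_num
    have hNpos : 0 < commSize (splitLabel z0 T u v S) w := by have := hbig w; omega
    have hNpos' : (0 : ℝ) < commSize (splitLabel z0 T u v S) w := by exact_mod_cast hNpos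
    have hσ1 : (c w : ℝ) ≤ (splitPart T S u v w).card + 1 := by exact_mod_cast (by omega)
    have hσ2 : ((splitPart T S u v w).card : ℝ) ≤ c w + 1 := by exact_mod_cast (by omega)
    have hN' : (commSize (splitLabel z0 T u v S) w : ℝ) =
        commSize zs w + (splitPart T S u v w).card - c w := by
      rw [eq_sub_iff_add_eq]; exact_mod_cast hN
    have hX := sum_splitLabel z0 hS huv w θ
    have hSp0 : 0 ≤ ∑ i ∈ splitPart T S u v w, θ i := Finset.sum_nonneg fun i _ => hθ i
    have hSp1 : ∑ i ∈ splitPart T S u v w, θ i ≤ (splitPart T S u v w).card * (1 + δ) := by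
      have := Finset.sum_le_card_nsmul (splitPart T S u v w) θ (1 + δ)
        fun i hi => hTmax i (splitPart_subset hS u v w hi)
      rwa [nsmul_eq_mul] at this
    have hF0 : 0 ≤ ∑ i ∈ F w, θ i := Finset.sum_nonneg fun i _ => hθ i
    have hcw : (c w : ℝ) ≤ a + 1 := by exact_mod_cast hcle w
    have hcw' := mul_le_mul_of_nonneg_right hcw hδ.le
    have h1 := hDlow w
    have h2 := hDup w
    have h3 := hClow w
    have h4 := hCup w
    have h5 := hFup w
    have h6 := hsize w
    have h7 := mul_nonneg hδ.le (Nat.cast_nonneg (α := ℝ) a)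
    have h8 := Nat.cast_nonneg (α := ℝ) a
    unfold commAvg
    rw [hX, Set.mem_Icc, le_div_iff₀ hNpos', div_le_iff₀ hNpos', hN']
    constructor
    · have h9 : (1 - δ) * ((splitPart T S u v w).card - c w : ℝ) ≤ 1 + δ := by
        nlinarith
      linarith
    · linarith

/-! ### A non-asymptotic lower bound -/

theorem sum_commSize {n k : ℕ} (z : Fin n → Fin k) : ∑ w, commSize z w = n := by
  have := Finset.card_eq_sum_card_fiberwise (f := z) (s := Finset.univ) (t := Finset.univ)
    (fun _ _ => Finset.mem_coe.2 (Finset.mem_univ _))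
  rw [Finset.card_univ, Fintype.card_fin] at this
  exact this.symm

/-- The sizes of the communities in Condition N. A largest community `w₀` can spare a node, and the
first two communities, when they are not the largest, can take one more. -/
theorem ConditionN.exists_label {n k : ℕ} {θ : Fin n → ℝ} {β δ : ℝ} (hβ : 1 ≤ β) (hk : 2 ≤ k)
    (hN : ConditionN n θ k β δ) :
    ∃ (z : Fin n → Fin k) (w₀ : Fin k),
      (∀ w, commAvg θ z w ∈ Set.Ioo (1 - δ / 4) (1 + δ / 4)) ∧
      (∀ w, (n : ℝ) / (β * k) - 1 ≤ commSize z w ∧ (commSize z w : ℝ) ≤ β * n / k + 1) ∧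
      (n : ℝ) / (β * k) ≤ commSize z w₀ ∧
      ∀ w : Fin k, w.val < 2 →
        (commSize z w : ℝ) ≤ (if k = 2 then (n : ℝ) / 2 else (n : ℝ) / (β * k)) + 1 ∧
        (w ≠ w₀ → (commSize z w : ℝ) ≤ β * n / k) := by
  obtain ⟨z, havg, h2, h3⟩ := hN
  have hk0 : (0 : ℝ) < k := by exact_mod_cast (by omega : 0 < k)
  have hn0 : (0 : ℝ) ≤ n := Nat.cast_nonneg n
  have hβ0 : 0 < β := by linarith
  have hle : (n : ℝ) / (β * k) ≤ n / k :=
    div_le_div_of_nonneg_left hn0 hk0 (le_mul_of_one_le_left hk0.le hβ)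
  have hle' : (n : ℝ) / k ≤ β * n / k := by
    gcongr; exact le_mul_of_one_le_left hn0 hβ
  have hsum := sum_commSize z
  obtain ⟨w₀, -, hw₀⟩ := Finset.exists_max_image Finset.univ (commSize z)
    ⟨⟨0, by omega⟩, Finset.mem_univ _⟩
  have hmax : (n : ℝ) / k ≤ commSize z w₀ := by
    rw [div_le_iff₀ hk0]
    have h := Finset.sum_le_card_nsmul Finset.univ (commSize z) _ hw₀
    rw [hsum, Finset.card_univ, Fintype.card_fin, smul_eq_mul, mul_comm] at h
    exact_mod_cast h
  refine ⟨z, w₀, havg, ?_, hle.trans hmax, ?_⟩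
  · intro w
    rcases hk.eq_or_lt with hk2 | hk3
    · have hw := w.isLt
      have hnat : n / 2 ≤ commSize z w ∧ commSize z w ≤ n / 2 + 1 := by
        rcases (by omega : w.val = 0 ∨ w.val = 1) with h | h
        · have := (h2 hk2.symm w).1 h; omega
        · have := (h2 hk2.symm w).2 h; omega
      have h4 : n ≤ 2 * commSize z w + 1 := by omega
      have h5 : 2 * commSize z w ≤ n + 2 := by omega
      have h4' : (n : ℝ) ≤ 2 * commSize z w + 1 := by exact_mod_cast h4
      have h5' : 2 * (commSize z w : ℝ) ≤ n + 2 := by exact_mod_cast h5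
      have hk2' : (k : ℝ) = 2 := by exact_mod_cast hk2.symm
      rw [hk2'] at hle hle' ⊢
      constructor <;> linarith
    · obtain ⟨hmono, hfl, hup⟩ := h3 hk3
      refine ⟨?_, hup w⟩
      have h4 : commSize z ⟨0, by omega⟩ ≤ commSize z w := hmono (Nat.zero_le _)
      rw [hfl _ (by simp)] at h4
      have h5 := Nat.sub_one_lt_floor ((n : ℝ) / (β * k))
      have h6 : ((⌊(n : ℝ) / (β * k)⌋₊ : ℕ) : ℝ) ≤ commSize z w := by exact_mod_cast h4
      linarith
  · intro w hw
    rcases hk.eq_or_lt with hk2 | hk3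
    · rw [if_pos hk2.symm]
      have hnat : commSize z w ≤ n / 2 + 1 := by
        rcases (by omega : w.val = 0 ∨ w.val = 1) with h | h
        · have := (h2 hk2.symm w).1 h; omega
        · have := (h2 hk2.symm w).2 h; omega
      have h5 : 2 * commSize z w ≤ n + 2 := by omega
      have h5' : 2 * (commSize z w : ℝ) ≤ n + 2 := by exact_mod_cast h5
      refine ⟨by linarith, fun hne => ?_⟩
      have h6 : commSize z w + commSize z w₀ ≤ n := by
        refine le_trans (le_of_eq (Finset.sum_pair hne).symm)
          (le_trans (Finset.sum_le_sum_of_subset (Finset.subset_univ _)) hsum.le)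
      have h7 := hw₀ w (Finset.mem_univ _)
      have h8 : 2 * commSize z w ≤ n := by omega
      have h8' : 2 * (commSize z w : ℝ) ≤ n := by exact_mod_cast h8
      have hk2' : (k : ℝ) = 2 := by exact_mod_cast hk2.symm
      rw [hk2'] at hle' ⊢
      linarith
    · obtain ⟨-, hfl, -⟩ := h3 hk3
      rw [if_neg (by omega), hfl w hw]
      have h5 := Nat.floor_le (by positivity : 0 ≤ (n : ℝ) / (β * k))
      exact ⟨by linarith, fun _ => by linarith⟩

/-- Jensen's inequality for the averages defining `rateI`. -/
theorem exp_neg_mul_rateI_le {n : ℕ} (hn : 0 < n) (θ : Fin n → ℝ) (p q : ℝ) (k : ℕ) (β : ℝ) {c : ℝ}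
    (hc : 1 ≤ c) :
    Real.exp (-(c * rateI n θ p q k β)) ≤ 1 / (n : ℝ) * ∑ i, Real.exp
      (-(c * (θ i * (if k = 2 then (n : ℝ) / 2 else (n : ℝ) / (β * k)) * (√p - √q) ^ 2))) := by
  have hn' : (0 : ℝ) < n := by exact_mod_cast hn
  set J : Fin n → ℝ := fun i =>
    θ i * (if k = 2 then (n : ℝ) / 2 else (n : ℝ) / (β * k)) * (√p - √q) ^ 2 with hJ
  have hI : rateI n θ p q k β = -Real.log (1 / (n : ℝ) * ∑ i, Real.exp (-J i)) := rfl
  have h := Real.rpow_arith_mean_le_arith_mean_rpow Finset.univ (fun _ : Fin n => 1 / (n : ℝ))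
    (fun i => Real.exp (-J i)) (fun _ _ => by positivity)
    (by rw [Finset.sum_const, Finset.card_univ, Fintype.card_fin, nsmul_eq_mul]; field_simp)
    (fun _ _ => (Real.exp_pos _).le) hc
  rw [← Finset.mul_sum, ← Finset.mul_sum] at h
  have hpos : 0 < 1 / (n : ℝ) * ∑ i, Real.exp (-J i) := by
    have : Nonempty (Fin n) := ⟨⟨0, hn⟩⟩
    exact mul_pos (by positivity)
      (Finset.sum_pos (fun _ _ => Real.exp_pos _) Finset.univ_nonempty)
  rw [Real.rpow_def_of_pos hpos] at h
  rw [hI]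
  have h2 : ∀ i, Real.exp (-J i) ^ c = Real.exp (-(c * J i)) := fun i => by
    rw [← Real.exp_mul]; ring_nf
  simp_rw [h2] at h
  refine le_trans (le_of_eq ?_) h
  ring_nf

/-- The minimax lower bound for fixed `n`. The number of uncertain labels is `2a + 1`, and `c` is
the inflation of the rate. -/
theorem le_minimaxRisk {n k a : ℕ} {θ : Fin n → ℝ} (hθ : ∀ i, 0 ≤ θ i) {p q β δ ω K η c : ℝ}
    (hβ : 1 ≤ β) (hk : 2 ≤ k) (hq : 0 < q) (hpq : q < p) (hK : p / q ≤ K)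
    (hpω : ∀ i j, p * (θ i * θ j) ≤ ω) (hω : ω ≤ 1 / 2) (hδ : 0 < δ) (hη : 0 < η)
    (hN : ConditionN n θ k β δ)
    (hsize : (3 * a + 2) * (1 + δ) ≤ 3 / 4 * δ * ((n : ℝ) / (β * k) - 1)) (hc1 : 1 ≤ c)
    (hc : (1 + δ) * ((if k = 2 then (n : ℝ) / 2 else (n : ℝ) / (β * k)) + 2) *
        (1 + 4 * ω + 2 * η * (4 * K + 8)) ≤
      c * (if k = 2 then (n : ℝ) / 2 else (n : ℝ) / (β * k))) :
    ENNReal.ofReal ((2 * a + 1) / (8 * n) * Real.exp (-(1 / (2 * η))) *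
      Real.exp (-(c * rateI n θ p q k β))) ≤ minimaxRisk n θ p q k β δ := by
  have hp : 0 < p := hq.trans hpq
  obtain ⟨zs, w₀, havg, hsz, hw₀, hsz2⟩ := hN.exists_label hβ hk
  set u : Fin k := ⟨0, by omega⟩ with hu
  set v : Fin k := ⟨1, by omega⟩ with hv
  have huv : u ≠ v := by simp [hu, hv]
  have hx1 : 0 < (n : ℝ) / (β * k) - 1 := by
    have h1 : 0 < (3 * (a : ℝ) + 2) * (1 + δ) := by positivity
    exact pos_of_mul_pos_right (h1.trans_le hsize) (by positivity)
  obtain ⟨T, z0, hTcard, hTmin, hTD, hS⟩ := exists_base_label (a := a) hθ hδ havg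
    (fun w => hsize.trans (mul_le_mul_of_nonneg_left (hsz w).1 (by positivity))) huv w₀
  have hn : 0 < n := by
    have h1 : T.card ≤ n := by simpa using Finset.card_le_univ T
    omega
  have hn' : (0 : ℝ) < n := by exact_mod_cast hn
  have hD0 : 0 ≤ (√p - √q) ^ 2 := sq_nonneg _
  have hJensen := exp_neg_mul_rateI_le hn θ p q k β hc1
  set M : ℝ := if k = 2 then (n : ℝ) / 2 else (n : ℝ) / (β * k) with hM
  set z := splitLabel z0 T u v with hz
  have hlow : ∀ S ⊆ T, (S.card = a ∨ S.card = a + 1) → ∀ w,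
      (n : ℝ) / (β * k) - 1 ≤ commSize (z S) w := by
    intro S hST hSc w
    have h := (hS S hST hSc w).2.1
    by_cases hw : w = w₀
    · rw [if_pos hw, hw] at h
      have h' : (commSize zs w₀ : ℝ) ≤ commSize (z S) w₀ + 1 := by exact_mod_cast h
      rw [hw]; linarith
    · rw [if_neg hw, add_zero] at h
      have h' : (commSize zs w : ℝ) ≤ commSize (z S) w := by exact_mod_cast h
      linarith [(hsz w).1]
  have hweight : ∀ S ⊆ T, (S.card = a ∨ S.card = a + 1) → ∀ (i : Fin n) (w : Fin k), w.val < 2 →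
      ∑ j ∈ (Finset.univ.erase i).filter (fun j => z S j = w), θ j ≤ (1 + δ) * (M + 2) := by
    intro S hST hSc i w hw
    have h1 := (hS S hST hSc w).1.2
    have hpos : (0 : ℝ) < commSize (z S) w := hx1.trans_le (hlow S hST hSc w)
    unfold commAvg at h1
    rw [div_le_iff₀ hpos] at h1
    have h2 := (hS S hST hSc w).2.2
    have h3 : commSize (z S) w ≤ commSize zs w + 1 := h2.trans (by split_ifs <;> omega)
    have h3' : (commSize (z S) w : ℝ) ≤ commSize zs w + 1 := by exact_mod_cast h3
    have h4 := (hsz2 w hw).1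
    calc ∑ j ∈ (Finset.univ.erase i).filter (fun j => z S j = w), θ j
        ≤ ∑ j ∈ Finset.univ.filter (fun j => z S j = w), θ j :=
          Finset.sum_le_sum_of_subset_of_nonneg
            (Finset.filter_subset_filter _ (Finset.erase_subset _ _)) fun j _ _ => hθ j
      _ ≤ (1 + δ) * commSize (z S) w := h1
      _ ≤ (1 + δ) * (M + 2) := by gcongr; linarith
  have hP : ∀ S i j, blockMatrix θ p q (z S) i j ∈ Set.Icc (0 : ℝ) 1 := by
    intro S i j
    unfold blockMatrix
    by_cases hij : i = j
    · simp [hij]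
    · rw [if_neg hij]
      have hu0 : 0 ≤ θ i * θ j := mul_nonneg (hθ i) (hθ j)
      have hpq' : 0 ≤ (if z S i = z S j then p else q) ∧ (if z S i = z S j then p else q) ≤ p := by
        split_ifs <;> constructor <;> linarith
      refine ⟨mul_nonneg hu0 hpq'.1, ?_⟩
      have := mul_le_mul_of_nonneg_left hpq'.2 hu0
      linarith [hpω i j]
  set f : Fin n → ℝ := fun i => Real.exp (-(θ i * ((1 + δ) * (M + 2)) * (√p - √q) ^ 2 *
    (1 + 4 * ω + 2 * η * (4 * K + 8)) + 1 / (2 * η))) with hf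
  have hmin : ∀ i ∈ T, ∀ S ∈ Finset.powersetCard a (T.erase i),
      f i ≤ ∑ A : Adjacency n, min (prob (blockMatrix θ p q (z S)) A)
        (prob (blockMatrix θ p q (z (insert i S))) A) := by
    intro i hi S hSm
    obtain ⟨hSsub, hScard⟩ := Finset.mem_powersetCard.1 hSm
    have hiS : i ∉ S := fun h => Finset.notMem_erase i T (hSsub h)
    have hST : S ⊆ T := hSsub.trans (Finset.erase_subset _ _)
    refine exp_le_sum_min_prob hθ hq hpq hK hpω hω huv.symm ?_ ?_ ?_
      (hweight S hST (Or.inl hScard) i v (by simp [hv]))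
      (hweight S hST (Or.inl hScard) i u (by simp [hu])) hη
    · simp [hz, splitLabel, hi, hiS]
    · simp [hz, splitLabel, hi]
    · intro j hj
      simp [hz, splitLabel, Finset.mem_insert, hj]
  -- the sum over `T` of the testing errors, compared with the average over all nodes
  have hsumf : (2 * a + 1) / (8 * n) * Real.exp (-(1 / (2 * η))) *
      Real.exp (-(c * rateI n θ p q k β)) ≤ 1 / (8 * (n : ℝ)) * ∑ i ∈ T, f i := by
    set g : Fin n → ℝ := fun i => Real.exp (-(c * (θ i * M * (√p - √q) ^ 2))) with hg
    have hM0 : 0 ≤ M := by rw [hM]; split_ifs <;> positivity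
    have hfg : ∀ i, Real.exp (-(1 / (2 * η))) * g i ≤ f i := by
      intro i
      rw [hg, hf, ← Real.exp_add, Real.exp_le_exp]
      have h1 := mul_le_mul_of_nonneg_left hc (mul_nonneg (hθ i) hD0)
      linarith
    have hgT : ((2 * a + 1 : ℕ) : ℝ) * ∑ i, g i ≤ n * ∑ i ∈ T, g i := by
      have h1 := card_mul_sum_le_of_smallest (fun i => -g i) (Finset.subset_univ T) (by
        intro i hi j hj
        simp only [hg, neg_le_neg_iff, Real.exp_le_exp]
        have := hTmin i hi j hj
        gcongr)
      rw [hTcard, Finset.card_univ, Fintype.card_fin, Finset.sum_neg_distrib,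
        Finset.sum_neg_distrib] at h1
      linarith
    have h2 : Real.exp (-(1 / (2 * η))) * ∑ i ∈ T, g i ≤ ∑ i ∈ T, f i := by
      rw [Finset.mul_sum]; exact Finset.sum_le_sum fun i _ => hfg i
    push_cast at hgT
    have hE := Real.exp_pos (-(1 / (2 * η)))
    calc (2 * a + 1) / (8 * n) * Real.exp (-(1 / (2 * η))) * Real.exp (-(c * rateI n θ p q k β))
        ≤ (2 * a + 1) / (8 * n) * Real.exp (-(1 / (2 * η))) * (1 / (n : ℝ) * ∑ i, g i) := by
          gcongr
      _ = 1 / (8 * n) * Real.exp (-(1 / (2 * η))) * (1 / n * ((2 * a + 1) * ∑ i, g i)) := by ring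
      _ ≤ 1 / (8 * n) * Real.exp (-(1 / (2 * η))) * (1 / n * (n * ∑ i ∈ T, g i)) := by gcongr
      _ = 1 / (8 * n) * (Real.exp (-(1 / (2 * η))) * ∑ i ∈ T, g i) := by field_simp
      _ ≤ 1 / (8 * n) * ∑ i ∈ T, f i := by gcongr
  refine le_iInf fun zhat => ?_
  obtain ⟨S, hST, hSc, hrisk⟩ := exists_le_risk hTcard hTD huv
    (fun S => blockMatrix θ p q (z S)) hP (fun i => (Real.exp_pos _).le) hmin zhat
  refine le_trans (ENNReal.ofReal_le_ofReal (hsumf.trans hrisk))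
    (le_iSup₂_of_le (z S, blockMatrix θ p q (z S)) ?_ le_rfl)
  refine ⟨hP S, fun w w' => if w = w' then p else q, ?_, ?_, ?_, fun w => (hS S hST hSc w).1, ?_,
    hpq, ?_, ?_⟩
  · ext w w'; exact if_congr eq_comm rfl rfl
  · intro i; simp [blockMatrix]
  · intro i j hij; simp [blockMatrix, hij]
  · intro w w' hw; simp [hw]
  · intro w; simp
  · intro w
    refine ⟨hlow S hST hSc w, ?_⟩
    have h := (hS S hST hSc w).2.2
    split_ifs at h with hw
    · have h' : (commSize (z S) w : ℝ) ≤ commSize zs w + 1 := by exact_mod_cast h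
      have hw2 : w.val < 2 := by rcases hw.1 with h | h <;> simp [h, hu, hv]
      have := (hsz2 w hw2).2 hw.2
      change (commSize (z S) w : ℝ) ≤ _
      linarith
    · have h' : (commSize (z S) w : ℝ) ≤ commSize zs w := by exact_mod_cast h
      exact h'.trans (hsz w).2

/-! ### Asymptotics -/

/-- The choice of the number `2a + 1` of uncertain labels, about `δ x / 32` with `x = n / (βk)`. The
assumption `4 ≤ δ x` leaves room for one such label at least. -/
theorem floor_size_bound {δ x : ℝ} (hδ : 0 < δ) (hδ1 : δ ≤ 1 / 10) (hx : 4 ≤ δ * x) :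
    (3 * (⌊δ * x / 64⌋₊ : ℝ) + 2) * (1 + δ) ≤ 3 / 4 * δ * (x - 1) ∧
      δ * x / 64 ≤ 2 * (⌊δ * x / 64⌋₊ : ℝ) + 1 := by
  have h0 : 0 ≤ δ * x / 64 := by linarith
  have h1 := Nat.floor_le h0
  have h2 := Nat.lt_floor_add_one (δ * x / 64)
  have h3 : (0 : ℝ) ≤ ⌊δ * x / 64⌋₊ := Nat.cast_nonneg _
  refine ⟨?_, by linarith⟩
  calc (3 * (⌊δ * x / 64⌋₊ : ℝ) + 2) * (1 + δ) ≤ (3 * (δ * x / 64) + δ * x / 2) * (1 + 1 / 10) := by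
        gcongr
        linarith
    _ ≤ 3 / 4 * δ * (x - 1) := by linarith

/-- The lower bound with `c = 1 + ε / 2`, in logarithmic form. -/
theorem log_le_log_minimaxRisk {n k : ℕ} {θ : Fin n → ℝ} (hθ : ∀ i, 0 ≤ θ i)
    {p q β δ ω K ε : ℝ} (hβ : 1 ≤ β) (hk : 2 ≤ k) (hq : 0 < q) (hpq : q < p) (hK : p / q ≤ K)
    (hpω : ∀ i j, p * (θ i * θ j) ≤ ω) (hω : ω ≤ 1 / 2) (hδ : 0 < δ) (hδ1 : δ ≤ 1 / 10)
    (hδn : 4 * β * k ≤ δ * n) (hε : 0 < ε) (hN : ConditionN n θ k β δ)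
    (hc : (1 + δ) * (1 + δ / 2) * (1 + 4 * ω + ε / 8) ≤ 1 + ε / 2) :
    ((-(Real.log (512 * β) + 8 * (4 * K + 8) / ε + Real.log k + Real.log (1 / δ)
        + (1 + ε / 2) * rateI n θ p q k β) : ℝ) : EReal) ≤
      ENNReal.log (minimaxRisk n θ p q k β δ) := by
  have hk0 : (0 : ℝ) < k := by exact_mod_cast (by omega : 0 < k)
  have hβ0 : 0 < β := by linarith
  have hK0 : 0 ≤ K := (div_pos (hq.trans hpq) hq).le.trans hK
  have hn0 : (0 : ℝ) < n :=
    pos_of_mul_pos_right ((by positivity : 0 < 4 * β * k).trans_le hδn) hδ.le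
  have hnn : 0 < n := by exact_mod_cast hn0
  have hω0 : 0 ≤ ω := (mul_nonneg (hq.trans hpq).le (mul_nonneg (hθ _) (hθ _))).trans
    (hpω ⟨0, hnn⟩ ⟨0, hnn⟩)
  set x : ℝ := (n : ℝ) / (β * k) with hx
  have hx4 : 4 ≤ δ * x := by
    rw [hx, ← mul_div_assoc, le_div_iff₀ (by positivity)]; linarith
  obtain ⟨hsize, hlarge⟩ := floor_size_bound hδ hδ1 hx4
  set a := ⌊δ * x / 64⌋₊ with ha
  -- with this `η` the variance term amounts to `ε / 8`
  set η : ℝ := ε / (16 * (4 * K + 8)) with hη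
  have hη0 : 0 < η := by positivity
  have hη1 : 2 * η * (4 * K + 8) = ε / 8 := by rw [hη]; field_simp; norm_num
  have hη2 : 1 / (2 * η) = 8 * (4 * K + 8) / ε := by rw [hη]; field_simp; norm_num
  have hMx : x ≤ if k = 2 then (n : ℝ) / 2 else x := by
    split_ifs with h2
    · rw [hx, h2]; push_cast
      apply div_le_div_of_nonneg_left hn0.le (by norm_num); linarith
    · exact le_rfl
  have hmain := le_minimaxRisk (a := a) (c := 1 + ε / 2) hθ hβ hk hq hpq hK hpω hω hδ hη0 hN hsize
    (by linarith) (by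
      rw [hη1]
      set M : ℝ := if k = 2 then (n : ℝ) / 2 else x with hM
      have h1 : M + 2 ≤ (1 + δ / 2) * M := by
        have := mul_le_mul_of_nonneg_left hMx hδ.le
        linarith
      have hM0 : 0 ≤ M := le_trans (by positivity) hMx
      calc (1 + δ) * (M + 2) * (1 + 4 * ω + ε / 8)
          ≤ (1 + δ) * ((1 + δ / 2) * M) * (1 + 4 * ω + ε / 8) := by gcongr
        _ = (1 + δ) * (1 + δ / 2) * (1 + 4 * ω + ε / 8) * M := by ring
        _ ≤ (1 + ε / 2) * M := by gcongr)
  refine le_trans ?_ (ENNReal.log_monotone hmain)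
  set I := rateI n θ p q k β with hI
  have hpos : 0 < (2 * (a : ℝ) + 1) / (8 * n) * Real.exp (-(1 / (2 * η))) *
      Real.exp (-((1 + ε / 2) * I)) := by positivity
  rw [ENNReal.log_ofReal, if_neg (not_le.2 hpos), EReal.coe_le_coe_iff,
    Real.log_mul (by positivity) (Real.exp_ne_zero _),
    Real.log_mul (by positivity) (Real.exp_ne_zero _), Real.log_exp, Real.log_exp, hη2]
  have hfrac : δ / (512 * β * k) ≤ (2 * (a : ℝ) + 1) / (8 * n) := by
    calc δ / (512 * β * k) = δ * x / 64 / (8 * n) := by rw [hx]; field_simp; norm_num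
      _ ≤ (2 * (a : ℝ) + 1) / (8 * n) := by gcongr
  have hlog := Real.log_le_log (by positivity) hfrac
  rw [Real.log_div (by positivity) (by positivity), Real.log_mul (by positivity) (by positivity)]
    at hlog
  rw [one_div, Real.log_inv]
  linarith

end DCBM

theorem mainTheorem2
    (β : ℝ) (hβ : 1 ≤ β)
    (n k : ℕ → ℕ) (θ : ∀ m, Fin (n m) → ℝ) (p q δ : ℕ → ℝ)
    (hn : Tendsto n atTop atTop)
    (hk : ∀ m, 2 ≤ k m)
    (hθ : ∀ m i, 0 ≤ θ m i)
    (hq : ∀ m, 0 < q m) (hpq : ∀ m, q m < p m)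
    (hpqO : ∃ C : ℝ, ∀ m, p m / q m ≤ C)
    (hδpos : ∀ m, 0 < δ m) (hδ : Tendsto δ atTop (𝓝 0))
    (hδn : ∀ᶠ m in atTop, 4 * β * k m ≤ δ m * n m)
    (hI : Tendsto (fun m => DCBM.rateI (n m) (θ m) (p m) (q m) (k m) β) atTop atTop)
    (hpθ : Tendsto (fun m => p m * ‖θ m‖ ^ 2) atTop (𝓝 0))
    (hlogk : (fun m => Real.log (k m)) =o[atTop]
      fun m => DCBM.rateI (n m) (θ m) (p m) (q m) (k m) β)
    (hlogδ : (fun m => Real.log (1 / δ m)) =o[atTop]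
      fun m => DCBM.rateI (n m) (θ m) (p m) (q m) (k m) β)
    (hN : ∀ m, DCBM.ConditionN (n m) (θ m) (k m) β (δ m)) :
    (-1 : EReal) ≤ liminf (fun m =>
      ENNReal.log (DCBM.minimaxRisk (n m) (θ m) (p m) (q m) (k m) β (δ m)) /
        ((DCBM.rateI (n m) (θ m) (p m) (q m) (k m) β : ℝ) : EReal)) atTop := by
  obtain ⟨K, hK⟩ := hpqO
  rw [← EReal.ge_of_forall_gt_iff_ge]
  intro y hy
  have hy' : y < -1 := by
    rw [← EReal.coe_one, ← EReal.coe_neg] at hy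
    exact EReal.coe_lt_coe_iff.1 hy
  -- it remains to bound the liminf below by `y = -(1 + ε)`
  set ε : ℝ := -1 - y with hεdef
  have hε : 0 < ε := by linarith
  refine le_liminf_of_le (by isBoundedDefault) ?_
  have hlim : Tendsto (fun m => (1 + δ m) * (1 + δ m / 2) * (1 + 4 * (p m * ‖θ m‖ ^ 2) + ε / 8))
      atTop (𝓝 ((1 + 0) * (1 + 0 / 2) * (1 + 4 * 0 + ε / 8))) :=
    ((hδ.const_add 1).mul ((hδ.div_const 2).const_add 1)).mul
      (((hpθ.const_mul 4).const_add 1).add_const _)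
  have hc := hlim.eventually_le_const (u := 1 + ε / 2) (by linarith)
  have hω := hpθ.eventually_le_const (u := 1 / 2) (by norm_num)
  have hδ1 := hδ.eventually_le_const (u := 1 / 10) (by norm_num)
  have hIpos := hI.eventually_gt_atTop 0
  have hIbig := hI.eventually_ge_atTop
    ((Real.log (512 * β) + 8 * (4 * K + 8) / ε) / (ε / 8))
  have hk' := hlogk.bound (by positivity : 0 < ε / 8)
  have hδ' := hlogδ.bound (by positivity : 0 < ε / 8)
  filter_upwards [hc, hω, hδ1, hIpos, hIbig, hk', hδ', hδn] with m hc hω hδ1 hIpos hIbig hk' hδ' hδn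
  have hp : 0 < p m := (hq m).trans (hpq m)
  have hpω : ∀ i j, p m * (θ m i * θ m j) ≤ p m * ‖θ m‖ ^ 2 := by
    intro i j
    have h : ∀ i, θ m i ≤ ‖θ m‖ := fun i => (le_abs_self _).trans (norm_le_pi_norm (θ m) i)
    rw [sq]
    exact mul_le_mul_of_nonneg_left
      (mul_le_mul (h i) (h j) (hθ m j) (norm_nonneg _)) hp.le
  have hlog := DCBM.log_le_log_minimaxRisk (hθ m) hβ (hk m) (hq m) (hpq m) (hK m) hpω hω (hδpos m)
    hδ1 hδn hε (hN m) hc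
  set I := DCBM.rateI (n m) (θ m) (p m) (q m) (k m) β with hIdef
  refine le_trans ?_ (EReal.div_le_div_right_of_nonneg (by exact_mod_cast hIpos.le) hlog)
  rw [← EReal.coe_div, EReal.coe_le_coe_iff, le_div_iff₀ hIpos]
  rw [Real.norm_eq_abs, Real.norm_eq_abs, abs_of_pos hIpos] at hk' hδ'
  have h1 := (le_abs_self _).trans hk'
  have h2 := (le_abs_self _).trans hδ'
  rw [div_le_iff₀ (by positivity)] at hIbig
  have h3 : y = -(1 + ε) := by rw [hεdef]; ring
  have h4 := mul_pos hε hIpos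
  rw [h3]
  linarith
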